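/- Let $\mathcal N=\{1,\dots,N\}$. A group structure $\mathfrak G=\{\mathcal G_1,\dots,\mathcal G_M\}$ on $\mathcal N$ is a collection of sets $\mathcal G_j\subseteq\mathcal N$ with $\bigcup_j\mathcal G_j=\mathcal N$; let $\mathbf A^{\mathfrak G}\in\{0,1\}^{N\times M}$ be the matrix with $A^{\mathfrak G}_{ij}=1$ if and only if $i\in\mathcal G_j$. Its group graph has the groups as nodes and an edge between two distinct groups $\mathcal G_j,\mathcal G_k$ whenever $\mathcal G_j\cap\mathcal G_k\neq\emptyset$. The group structure is called loopless pairwise overlapping if each $i\in\mathcal N$ belongs to at most two groups and the group graph contains no cycle. There exist a single algorithm (a program for a random access machine with exact real arithmetic, in which each arithmetic operation $+,-$ on integers, $+,-,\times$ on reals, each comparison and each memory access costs one unit of time) and a polynomial $p$ such that, for all $N,M$, every loopless pairwise overlapping group structure $\mathfrak G$ with $M$ groups on $\{1,\dots,N\}$, every integer $G\ge 0$ and every $\mathbf x\in\mathbb R^N$, the algorithm, given $N$, $M$, $G$, $\mathbf A^{\mathfrak G}$ and $\mathbf x$, halts after at most $p(N+M)$ steps and returns an optimal solution $(\boldsymbol\omega,\mathbf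 y)$ of the weighted maximum coverage problem $$\max_{\boldsymbol\omega\in\{0,1\}^M,\ \mathbf y\in\{0,1\}^N}\Big\{\sum_{i=1}^N y_i x_i^2\ :\ \mathbf A^{\mathfrak G}\boldsymbol\omega\ge\mathbf y,\ \sum_{j=1}^M\omega_j\le G\Big\}.$$ -/

import Mathlib

/-! ### Real RAM

A random access machine with exact real arithmetic.  The memory consists of arrays of natural
numbers and arrays of real numbers.  The only primitive operations are: on natural numbers,
constants, indirect loads, addition, truncated subtraction and comparison; on real numbers, natural
constants, loads, addition, subtraction, multiplication and comparison.  (There is no rounding and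
no multiplication of addresses, and no constant other than natural numbers, so that no
information can be hidden in constants or in long words.)  Each primitive operation costs one unit.
Control flow is structured: sequencing, conditionals and while loops. -/

namespace RealRAM

/-- Memory: `nat a i` and `real a i` are the cells of index `i` in the arrays named `a`. -/
structure Store where
  nat : ℕ → ℕ → ℕ
  real : ℕ → ℕ → ℝ

/-- Natural number expressions. The name of an array is fixed in the program, the index is
computed. -/
inductive NatExpr where
  | lit (n : ℕ)
  | load (a : ℕ) (i : NatExpr)
  | add (e₁ e₂ : NatExpr)
  | sub (e₁ e₂ : NatExpr)

namespace NatExpr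

def value (s : Store) : NatExpr → ℕ
  | lit n => n
  | load a i => s.nat a (i.value s)
  | add e₁ e₂ => e₁.value s + e₂.value s
  | sub e₁ e₂ => e₁.value s - e₂.value s

/-- The number of primitive operations in an expression. -/
def cost : NatExpr → ℕ
  | lit _ => 1
  | load _ i => i.cost + 1
  | add e₁ e₂ => e₁.cost + e₂.cost + 1
  | sub e₁ e₂ => e₁.cost + e₂.cost + 1

end NatExpr

/-- Real number expressions. -/
inductive RealExpr where
  | lit (n : ℕ)
  | load (a : ℕ) (i : NatExpr)
  | add (e₁ e₂ : RealExpr)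
  | sub (e₁ e₂ : RealExpr)
  | mul (e₁ e₂ : RealExpr)

namespace RealExpr

noncomputable def value (s : Store) : RealExpr → ℝ
  | lit n => (n : ℝ)
  | load a i => s.real a (i.value s)
  | add e₁ e₂ => e₁.value s + e₂.value s
  | sub e₁ e₂ => e₁.value s - e₂.value s
  | mul e₁ e₂ => e₁.value s * e₂.value s

def cost : RealExpr → ℕ
  | lit _ => 1
  | load _ i => i.cost + 1
  | add e₁ e₂ => e₁.cost + e₂.cost + 1
  | sub e₁ e₂ => e₁.cost + e₂.cost + 1
  | mul e₁ e₂ => e₁.cost + e₂.cost + 1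

end RealExpr

/-- Tests: comparisons of natural numbers or of real numbers, and their Boolean combinations. -/
inductive Test where
  | natLe (e₁ e₂ : NatExpr)
  | realLe (e₁ e₂ : RealExpr)
  | not (b : Test)
  | and (b₁ b₂ : Test)

namespace Test

def Holds (s : Store) : Test → Prop
  | natLe e₁ e₂ => e₁.value s ≤ e₂.value s
  | realLe e₁ e₂ => e₁.value s ≤ e₂.value s
  | not b => ¬ b.Holds s
  | and b₁ b₂ => b₁.Holds s ∧ b₂.Holds s

def cost : Test → ℕ
  | natLe e₁ e₂ => e₁.cost + e₂.cost + 1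
  | realLe e₁ e₂ => e₁.cost + e₂.cost + 1
  | not b => b.cost + 1
  | and b₁ b₂ => b₁.cost + b₂.cost + 1

end Test

/-- Programs. `setNat a i e` and `setReal a i e` store the value of `e` in cell `i` of array `a`;
`loop b c` repeats `c` as long as `b` holds. -/
inductive Program where
  | skip
  | setNat (a : ℕ) (i e : NatExpr)
  | setReal (a : ℕ) (i : NatExpr) (e : RealExpr)
  | seq (c₁ c₂ : Program)
  | ite (b : Test) (c₁ c₂ : Program)
  | loop (b : Test) (c : Program)

def Store.setNat (s : Store) (a i v : ℕ) : Store :=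
  { s with nat := Function.update s.nat a (Function.update (s.nat a) i v) }

noncomputable def Store.setReal (s : Store) (a i : ℕ) (v : ℝ) : Store :=
  { s with real := Function.update s.real a (Function.update (s.real a) i v) }

/-- `Runs c s s' t`: started in the store `s`, the program `c` halts in the store `s'` after
exactly `t` steps. -/
inductive Runs : Program → Store → Store → ℕ → Prop
  | skip (s : Store) : Runs .skip s s 1
  | setNat (s : Store) (a : ℕ) (i e : NatExpr) :
      Runs (.setNat a i e) s (s.setNat a (i.value s) (e.value s)) (i.cost + e.cost + 1)
  | setReal (s : Store) (a : ℕ) (i : NatExpr) (e : RealExpr) :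
      Runs (.setReal a i e) s (s.setReal a (i.value s) (e.value s)) (i.cost + e.cost + 1)
  | seq {c₁ c₂ : Program} {s s' s'' : Store} {t₁ t₂ : ℕ} :
      Runs c₁ s s' t₁ → Runs c₂ s' s'' t₂ → Runs (.seq c₁ c₂) s s'' (t₁ + t₂)
  | iteTrue {b : Test} {c₁ c₂ : Program} {s s' : Store} {t : ℕ} :
      b.Holds s → Runs c₁ s s' t → Runs (.ite b c₁ c₂) s s' (b.cost + t + 1)
  | iteFalse {b : Test} {c₁ c₂ : Program} {s s' : Store} {t : ℕ} :
      ¬ b.Holds s → Runs c₂ s s' t → Runs (.ite b c₁ c₂) s s' (b.cost + t + 1)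
  | loopDone {b : Test} {c : Program} {s : Store} :
      ¬ b.Holds s → Runs (.loop b c) s s (b.cost + 1)
  | loopStep {b : Test} {c : Program} {s s' s'' : Store} {t₁ t₂ : ℕ} :
      b.Holds s → Runs c s s' t₁ → Runs (.loop b c) s' s'' t₂ →
        Runs (.loop b c) s s'' (b.cost + 1 + t₁ + t₂)

end RealRAM

/-! ### Group structures -/

/-- A group structure with `M` groups over the ground set `Fin N`. -/
structure GroupStructure (N M : ℕ) where
  group : Fin M → Finset (Fin N)
  cover : ∀ i : Fin N, ∃ j : Fin M, i ∈ group j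

namespace GroupStructure

variable {N M : ℕ}

/-- The variables-groups bi-adjacency matrix. -/
def biadj (𝔊 : GroupStructure N M) : Matrix (Fin N) (Fin M) ℕ :=
  Matrix.of fun i j => if i ∈ 𝔊.group j then 1 else 0

/-- The group graph: the nodes are the groups, edges connect distinct groups that overlap. -/
def groupGraph (𝔊 : GroupStructure N M) : SimpleGraph (Fin M) where
  Adj j k := j ≠ k ∧ (𝔊.group j ∩ 𝔊.group k).Nonempty
  symm := ⟨fun _ _ h => ⟨h.1.symm, by rw [Finset.inter_comm]; exact h.2⟩⟩
  loopless := ⟨fun _ h => h.1 rfl⟩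

/-- Each index lies in at most two groups and the group graph has no cycle. -/
def LooplessPairwiseOverlapping (𝔊 : GroupStructure N M) : Prop :=
  (∀ i : Fin N, (Finset.univ.filter fun j : Fin M => i ∈ 𝔊.group j).card ≤ 2) ∧
    𝔊.groupGraph.IsAcyclic

end GroupStructure

/-! ### The weighted maximum coverage problem -/

namespace WMC

variable {N M : ℕ}

/-- A feasible pair: binary vectors `ω` (selected groups) and `y` (selected variables) with
`A ω ≥ y` and `∑ ω_j ≤ G`. -/
def Feasible (𝔊 : GroupStructure N M) (G : ℕ) (ω : Fin M → ℕ) (y : Fin N → ℕ) : Prop :=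
  (∀ j, ω j = 0 ∨ ω j = 1) ∧ (∀ i, y i = 0 ∨ y i = 1) ∧
    (∀ i, y i ≤ (𝔊.biadj.mulVec ω) i) ∧ ∑ j, ω j ≤ G

noncomputable def objective (x : Fin N → ℝ) (y : Fin N → ℕ) : ℝ :=
  ∑ i, (y i : ℝ) * x i ^ 2

/-- `(ω, y)` is an optimal solution. -/
def IsSolution (𝔊 : GroupStructure N M) (G : ℕ) (x : Fin N → ℝ)
    (ω : Fin M → ℕ) (y : Fin N → ℕ) : Prop :=
  Feasible 𝔊 G ω y ∧
    ∀ (ω' : Fin M → ℕ) (y' : Fin N → ℕ), Feasible 𝔊 G ω' y' → objective x y' ≤ objective x y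

/-- The initial memory for an instance. The natural number array `0` holds `N, M, G`, the array `1`
holds the bi-adjacency matrix row by row (entry `(i, j)` in cell `i * M + j`), the real array `0`
holds the signal `x`; all other cells are `0`. -/
noncomputable def input (𝔊 : GroupStructure N M) (G : ℕ) (x : Fin N → ℝ) : RealRAM.Store where
  nat a k :=
    match a with
    | 0 => match k with
      | 0 => N
      | 1 => M
      | 2 => G
      | _ => 0
    | 1 => if h : k < N * M then 𝔊.biadj (Fin.divNat ⟨k, h⟩) (Fin.modNat ⟨k, h⟩) else 0
    | _ => 0
  real a k :=
    match a with
    | 0 => if h : k < N then x ⟨k, h⟩ else 0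
    | _ => 0

/-- The output vector `ω` is read from the natural number array `2`. -/
def outputGroups (M : ℕ) (s : RealRAM.Store) : Fin M → ℕ := fun j => s.nat 2 j

/-- The output vector `y` is read from the natural number array `3`. -/
def outputVariables (N : ℕ) (s : RealRAM.Store) : Fin N → ℕ := fun i => s.nat 3 i

end WMC

/-! Let $f(S)$ be the weight of the union of the groups in $S$, and let $c_{ab}$ be the weight of
the intersection of the groups $a$ and $b$. Since no index lies in three groups, inclusion-exclusion
stops at pairs: for disjoint $A,B$ one has $f(A\cup B)=f(A)+f(B)-\sum_{a\in A,b\in B}c_{ab}$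
(`coverage_union`). Because weights are nonnegative, the best `y` for a given `ω` marks everything
covered, so the task is to maximize $f$ over sets of at most $G$ groups
(`isSolution_of_optimalSelection`). The weights $c_{ab}$ vanish off the edges of a forest, and this
is a budgeted quadratic problem on a forest that dynamic programming solves.

The dynamic program needs no prescribed orientation of the forest. It keeps a partition of the
groups into blocks, one per surviving root, such that different blocks overlap through their roots
only (`Blocks`). For each root, each decision $b\in\{0,1\}$ about taking it and each budget $g$ for
the other nodes of its block, the table holds an optimal value and a set attaining it (`Entry`).
Among at least two surviving roots, one overlaps with at most one other; its block is merged into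
the block of that neighbour, or into any other block if it has none. The merged entries come from
distributing the budget over the two blocks, and the only correction is $b\,b'\,c_{uv}$ for the two
roots (`Entry.combine`, `Blocks.merge`). When one root is left its block is the whole set of groups,
and comparing the two decisions about that root gives the optimum (`optimal_of_tableReady`).

For the running time, nearly all of the program is written with counted loops whose bounds lie in an
array that is never changed after a constant-time preamble. The time is then a polynomial in the
largest loop bound, read off from the syntax (`runs_compile`). The capacity $G$ is not bounded in
terms of $N+M$, so it never serves as a loop bound, and it is cut down to $\min(G,M)$ before it is
used as a table index. -/

namespace RealRAM

/-! ### A language of bounded loops -/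

/-- Programs whose only loops are counted: `forLoop k n c` repeats `c` as often as the cell `n` of
the array `0` says, with the counter in the cell `0` of the array `k`. -/
inductive ForProgram where
  | skip
  | setNat (a : ℕ) (i e : NatExpr)
  | setReal (a : ℕ) (i : NatExpr) (e : RealExpr)
  | seq (c₁ c₂ : ForProgram)
  | ite (b : Test) (c₁ c₂ : ForProgram)
  | forLoop (k n : ℕ) (c : ForProgram)

/-- The content of the first cell of an array, used as a register. -/
abbrev reg (k : ℕ) : NatExpr := .load k (.lit 0)

/-! ### Evaluation of expressions and effect of assignments. -/

@[simp] theorem value_lit (s : Store) (n : ℕ) : (NatExpr.lit n).value s = n := rfl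
@[simp] theorem value_load (s : Store) (a : ℕ) (i : NatExpr) :
    (NatExpr.load a i).value s = s.nat a (i.value s) := rfl
@[simp] theorem value_add (s : Store) (e₁ e₂ : NatExpr) :
    (NatExpr.add e₁ e₂).value s = e₁.value s + e₂.value s := rfl
@[simp] theorem value_sub (s : Store) (e₁ e₂ : NatExpr) :
    (NatExpr.sub e₁ e₂).value s = e₁.value s - e₂.value s := rfl
@[simp] theorem realValue_lit (s : Store) (n : ℕ) : (RealExpr.lit n).value s = n := rfl
@[simp] theorem realValue_load (s : Store) (a : ℕ) (i : NatExpr) :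
    (RealExpr.load a i).value s = s.real a (i.value s) := rfl
@[simp] theorem realValue_add (s : Store) (e₁ e₂ : RealExpr) :
    (RealExpr.add e₁ e₂).value s = e₁.value s + e₂.value s := rfl
@[simp] theorem realValue_sub (s : Store) (e₁ e₂ : RealExpr) :
    (RealExpr.sub e₁ e₂).value s = e₁.value s - e₂.value s := rfl
@[simp] theorem realValue_mul (s : Store) (e₁ e₂ : RealExpr) :
    (RealExpr.mul e₁ e₂).value s = e₁.value s * e₂.value s := rfl
@[simp] theorem holds_natLe (s : Store) (e₁ e₂ : NatExpr) :
    (Test.natLe e₁ e₂).Holds s ↔ e₁.value s ≤ e₂.value s := Iff.rfl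
@[simp] theorem holds_realLe (s : Store) (e₁ e₂ : RealExpr) :
    (Test.realLe e₁ e₂).Holds s ↔ e₁.value s ≤ e₂.value s := Iff.rfl
@[simp] theorem holds_not (s : Store) (b : Test) : (Test.not b).Holds s ↔ ¬ b.Holds s := Iff.rfl
@[simp] theorem holds_and (s : Store) (b₁ b₂ : Test) :
    (Test.and b₁ b₂).Holds s ↔ b₁.Holds s ∧ b₂.Holds s := Iff.rfl

theorem nat_setNat (s : Store) (a i v b j : ℕ) :
    (s.setNat a i v).nat b j = if b = a ∧ j = i then v else s.nat b j := by
  by_cases h : b = a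
  · subst h
    simp [Store.setNat, Function.update_apply]
  · simp [Store.setNat, h]

theorem nat_setNat_of_ne (s : Store) {a b : ℕ} (i v : ℕ) (h : b ≠ a) :
    (s.setNat a i v).nat b = s.nat b := by
  simp [Store.setNat, h]

@[simp] theorem real_setNat (s : Store) (a i v : ℕ) : (s.setNat a i v).real = s.real := rfl

@[simp] theorem nat_setReal (s : Store) (a i : ℕ) (v : ℝ) : (s.setReal a i v).nat = s.nat := rfl

theorem real_setReal (s : Store) (a i : ℕ) (v : ℝ) (b j : ℕ) :
    (s.setReal a i v).real b j = if b = a ∧ j = i then v else s.real b j := by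
  by_cases h : b = a
  · subst h
    simp [Store.setReal, Function.update_apply]
  · simp [Store.setReal, h]

theorem real_setReal_of_ne (s : Store) {a b : ℕ} (i : ℕ) (v : ℝ) (h : b ≠ a) :
    (s.setReal a i v).real b = s.real b := by
  simp [Store.setReal, h]

namespace ForProgram

/-- The translation into a program of the machine. -/
def compile : ForProgram → Program
  | skip => .skip
  | setNat a i e => .setNat a i e
  | setReal a i e => .setReal a i e
  | seq c₁ c₂ => .seq c₁.compile c₂.compile
  | ite b c₁ c₂ => .ite b c₁.compile c₂.compile
  | forLoop k n c =>
      .seq (.setNat k (.lit 0) (.lit 0))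
        (.loop (.natLe (.add (reg k) (.lit 1)) (.load 0 (.lit n)))
          (.seq c.compile (.setNat k (.lit 0) (.add (reg k) (.lit 1)))))

open Classical in
/-- The store in which a program halts. -/
noncomputable def eval : ForProgram → Store → Store
  | skip, s => s
  | setNat a i e, s => s.setNat a (i.value s) (e.value s)
  | setReal a i e, s => s.setReal a (i.value s) (e.value s)
  | seq c₁ c₂, s => c₂.eval (c₁.eval s)
  | ite b c₁ c₂, s => if b.Holds s then c₁.eval s else c₂.eval s
  | forLoop k n c, s =>
      Nat.rec (s.setNat k 0 0) (fun i s' => (c.eval s').setNat k 0 (i + 1)) (s.nat 0 n)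

/-- The arrays of natural numbers that a program may change. -/
def natWrites : ForProgram → List ℕ
  | skip => []
  | setNat a _ _ => [a]
  | setReal _ _ _ => []
  | seq c₁ c₂ => c₁.natWrites ++ c₂.natWrites
  | ite _ c₁ c₂ => c₁.natWrites ++ c₂.natWrites
  | forLoop k _ c => k :: c.natWrites

/-- The arrays of real numbers that a program may change. -/
def realWrites : ForProgram → List ℕ
  | skip => []
  | setNat _ _ _ => []
  | setReal a _ _ => [a]
  | seq c₁ c₂ => c₁.realWrites ++ c₂.realWrites
  | ite _ c₁ c₂ => c₁.realWrites ++ c₂.realWrites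
  | forLoop _ _ c => c.realWrites

/-- No loop changes its counter, and no loop is bounded by the cell `2` of the array `0`. -/
def WellFormed : ForProgram → Bool
  | skip => true
  | setNat _ _ _ => true
  | setReal _ _ _ => true
  | seq c₁ c₂ => c₁.WellFormed && c₂.WellFormed
  | ite _ c₁ c₂ => c₁.WellFormed && c₂.WellFormed
  | forLoop k n c => c.WellFormed && (decide (k ∉ c.natWrites) && decide (n ≠ 2))

/-- A bound for the running time in terms of a bound for the number of iterations of any loop. -/
noncomputable def timeBound : ForProgram → Polynomial ℕ
  | skip => 1
  | setNat _ i e => .C (i.cost + e.cost + 1)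
  | setReal _ i e => .C (i.cost + e.cost + 1)
  | seq c₁ c₂ => c₁.timeBound + c₂.timeBound
  | ite b c₁ c₂ => .C (b.cost + 1) + c₁.timeBound + c₂.timeBound
  | forLoop _ _ c => .X * (c.timeBound + .C 15) + .C 15

/-- The frame rule. Array names are fixed in the syntax, so the side condition is decidable and each
later use is settled by `decide`. -/
theorem eval_nat (c : ForProgram) (s : Store) {a : ℕ} (h : a ∉ c.natWrites) :
    (c.eval s).nat a = s.nat a := by
  induction c generalizing s with
  | skip => rfl
  | setNat b i e => exact nat_setNat_of_ne _ _ _ (by simpa [natWrites] using h)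
  | setReal b i e => rfl
  | seq c₁ c₂ h₁ h₂ =>
    simp only [natWrites, List.mem_append, not_or] at h
    simp only [eval]
    rw [h₂ _ h.2, h₁ _ h.1]
  | ite b c₁ c₂ h₁ h₂ =>
    simp only [natWrites, List.mem_append, not_or] at h
    simp only [eval]
    split_ifs
    exacts [h₁ _ h.1, h₂ _ h.2]
  | forLoop k n c hc =>
    simp only [natWrites, List.mem_cons, not_or] at h
    simp only [eval]
    induction s.nat 0 n with
    | zero => exact nat_setNat_of_ne _ _ _ h.1
    | succ m ih => exact (nat_setNat_of_ne _ _ _ h.1).trans ((hc _ h.2).trans ih)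

theorem eval_real (c : ForProgram) (s : Store) {a : ℕ} (h : a ∉ c.realWrites) :
    (c.eval s).real a = s.real a := by
  induction c generalizing s with
  | skip => rfl
  | setNat b i e => rfl
  | setReal b i e => exact real_setReal_of_ne _ _ _ (by simpa [realWrites] using h)
  | seq c₁ c₂ h₁ h₂ =>
    simp only [realWrites, List.mem_append, not_or] at h
    simp only [eval]
    rw [h₂ _ h.2, h₁ _ h.1]
  | ite b c₁ c₂ h₁ h₂ =>
    simp only [realWrites, List.mem_append, not_or] at h
    simp only [eval]
    split_ifs
    exacts [h₁ _ h.1, h₂ _ h.2]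
  | forLoop k n c hc =>
    simp only [realWrites] at h
    simp only [eval]
    induction s.nat 0 n with
    | zero => rfl
    | succ m ih => exact (hc _ h).trans ih

/-- `eval` reads the bound of a loop once, while the compiled loop rereads it before every
iteration; the two agree because array `0` is never written. Cell `2` of that array is left out of
the bound because it holds the capacity, which may be arbitrarily large. -/
theorem runs_compile (c : ForProgram) (s : Store) {B : ℕ} (hw : c.WellFormed = true)
    (h0 : 0 ∉ c.natWrites) (hB : ∀ n, n ≠ 2 → s.nat 0 n ≤ B) :
    ∃ t, t ≤ c.timeBound.eval B ∧ Runs c.compile s (c.eval s) t := by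
  induction c generalizing s with
  | skip => exact ⟨1, by simp [timeBound], .skip s⟩
  | setNat a i e => exact ⟨_, by simp [timeBound], .setNat s a i e⟩
  | setReal a i e => exact ⟨_, by simp [timeBound], .setReal s a i e⟩
  | seq c₁ c₂ h₁ h₂ =>
    simp only [natWrites, List.mem_append, not_or] at h0
    simp only [WellFormed, Bool.and_eq_true] at hw
    obtain ⟨t₁, ht₁, r₁⟩ := h₁ s hw.1 h0.1 hB
    obtain ⟨t₂, ht₂, r₂⟩ := h₂ (c₁.eval s) hw.2 h0.2
      (fun n hn => by rw [eval_nat c₁ s h0.1]; exact hB n hn)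
    exact ⟨t₁ + t₂, by simp only [timeBound, Polynomial.eval_add]; omega, .seq r₁ r₂⟩
  | ite b c₁ c₂ h₁ h₂ =>
    simp only [natWrites, List.mem_append, not_or] at h0
    simp only [WellFormed, Bool.and_eq_true] at hw
    obtain ⟨t₁, ht₁, r₁⟩ := h₁ s hw.1 h0.1 hB
    obtain ⟨t₂, ht₂, r₂⟩ := h₂ s hw.2 h0.2 hB
    simp only [timeBound, eval, Polynomial.eval_add, Polynomial.eval_C]
    split_ifs with hb
    · exact ⟨b.cost + t₁ + 1, by omega, .iteTrue hb r₁⟩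
    · exact ⟨b.cost + t₂ + 1, by omega, .iteFalse hb r₂⟩
  | forLoop k n c hc =>
    simp only [natWrites, List.mem_cons, not_or] at h0
    simp only [WellFormed, Bool.and_eq_true, decide_eq_true_eq] at hw
    obtain ⟨hw, hk, hn⟩ := hw
    have h0k : 0 ≠ k := h0.1
    set f : ℕ → Store := fun m =>
      Nat.rec (s.setNat k 0 0) (fun i s' => (c.eval s').setNat k 0 (i + 1)) m with hf
    have hf0 : ∀ m, (f m).nat 0 = s.nat 0 := by
      intro m
      induction m with
      | zero => exact nat_setNat_of_ne _ _ _ h0k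
      | succ m ih => exact (nat_setNat_of_ne _ _ _ h0k).trans ((eval_nat c _ h0.2).trans ih)
    have hfk : ∀ m, (f m).nat k 0 = m := by
      intro m
      cases m with
      | zero => simp [hf, nat_setNat]
      | succ m => simp [hf, nat_setNat]
    -- A run of a loop is built from its end, so the induction is on the number `d` of iterations
    -- still to come. The constants 15 and 12 absorb the costs of the test and of the counter
    -- update, and of the final failing test.
    have key : ∀ d m, m + d = s.nat 0 n → ∃ t, t ≤ d * (c.timeBound.eval B + 15) + 12 ∧
        Runs (.loop (.natLe (.add (reg k) (.lit 1)) (.load 0 (.lit n)))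
          (.seq c.compile (.setNat k (.lit 0) (.add (reg k) (.lit 1))))) (f m)
          (f (s.nat 0 n)) t := by
      intro d
      induction d with
      | zero =>
        intro m hm
        obtain rfl : m = s.nat 0 n := hm
        refine ⟨_, ?_, .loopDone ?_⟩
        · simp [Test.cost, NatExpr.cost]
        · simp [hfk, hf0]
      | succ d ih =>
        intro m hm
        obtain ⟨t, ht, r⟩ := ih (m + 1) (by omega)
        obtain ⟨t', ht', r'⟩ := hc (f m) hw h0.2 (fun j hj => by rw [hf0]; exact hB j hj)
        have hstep : (c.eval (f m)).setNat k 0 ((c.eval (f m)).nat k 0 + 1) = f (m + 1) := by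
          rw [eval_nat c _ hk, hfk]
        refine ⟨_, ?_, .loopStep ?_ (.seq r' (.setNat _ _ _ _)) (by
          simp only [value_lit, value_add, value_load]
          rw [hstep]; exact r)⟩
        · simp only [Test.cost, NatExpr.cost]
          have : (d + 1) * (c.timeBound.eval B + 15) =
            d * (c.timeBound.eval B + 15) + (c.timeBound.eval B + 15) := by ring
          omega
        · simp only [holds_natLe, value_add, value_load, value_lit, hfk, hf0]
          omega
    obtain ⟨t, ht, r⟩ := key (s.nat 0 n) 0 (by simp)
    refine ⟨_, ?_, .seq (.setNat _ _ _ _) r⟩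
    simp only [NatExpr.cost, timeBound, Polynomial.eval_add, Polynomial.eval_mul,
      Polynomial.eval_X, Polynomial.eval_C]
    have := Nat.mul_le_mul_right (c.timeBound.eval B + 15) (hB n hn)
    omega

/-- Induction along a loop. The induction predicate must not depend on the counter; in the step,
everything that the loop does not change is available from the store at its start. -/
theorem eval_forLoop_induction {k n : ℕ} {c : ForProgram} {s : Store} (P : ℕ → Store → Prop)
    (hcounter : ∀ i s' v, P i s' → P i (s'.setNat k 0 v)) (h0 : P 0 s)
    (hstep : ∀ i < s.nat 0 n, ∀ s' : Store,
      (∀ a, a ∉ k :: c.natWrites → s'.nat a = s.nat a) →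
      (∀ a, a ∉ c.realWrites → s'.real a = s.real a) →
      s'.nat k 0 = i → P i s' → P (i + 1) (c.eval s')) :
    P (s.nat 0 n) ((forLoop k n c).eval s) := by
  -- The invariant is strengthened by the frame conditions and by the value of the counter, which
  -- the step hypothesis may then use.
  have key : ∀ m ≤ s.nat 0 n, ∀ s' : Store,
      s' = Nat.rec (s.setNat k 0 0) (fun i s' => (c.eval s').setNat k 0 (i + 1)) m →
      (∀ a, a ∉ k :: c.natWrites → s'.nat a = s.nat a) ∧
      (∀ a, a ∉ c.realWrites → s'.real a = s.real a) ∧ s'.nat k 0 = m ∧ P m s' := by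
    intro m
    induction m with
    | zero =>
      rintro - s' rfl
      refine ⟨fun a ha => nat_setNat_of_ne _ _ _ ?_, fun a _ => rfl, by simp [nat_setNat],
        hcounter _ _ _ h0⟩
      rintro rfl; simp at ha
    | succ m ih =>
      rintro hm s' rfl
      obtain ⟨h1, h2, h3, h4⟩ := ih (by omega) _ rfl
      refine ⟨fun a ha => ?_, fun a ha => ?_, by simp [nat_setNat],
        hcounter _ _ _ (hstep m hm _ h1 h2 h3 h4)⟩
      · have ha' := ha
        simp only [List.mem_cons, not_or] at ha'
        exact (nat_setNat_of_ne _ _ _ ha'.1).trans ((eval_nat c _ ha'.2).trans (h1 a ha))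
      · exact (eval_real c _ ha).trans (h2 a ha)
  exact (key _ le_rfl _ rfl).2.2.2

end ForProgram

end RealRAM

/-! ### Leaves of a forest -/

/-- Among at least two nodes of a forest, one has at most one neighbour. -/
theorem SimpleGraph.IsAcyclic.exists_mem_forall_not_adj {V : Type*} {G : SimpleGraph V}
    (hG : G.IsAcyclic) (R : Finset V) (hR : 2 ≤ R.card) :
    ∃ v ∈ R, ∃ u ∈ R, v ≠ u ∧ ∀ w ∈ R, w ≠ v → w ≠ u → ¬ G.Adj v w := by
  classical
  have hH : (G.induce (R : Set V)).IsAcyclic := hG.induce _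
  have hne : R.Nonempty := Finset.card_pos.mp (by omega)
  have : Nonempty (R : Set V) := ⟨⟨hne.choose, hne.choose_spec⟩⟩
  have : Finite (R : Set V) := Finset.finite_toSet R
  -- The starting point of a longest path in the induced graph is the required node. A neighbour on
  -- the path must be the second vertex, since there is no cycle; a neighbour off the path would
  -- extend it.
  obtain ⟨a, z, p, hp, hmax⟩ :=
    SimpleGraph.Walk.exists_isPath_forall_isPath_length_le_length (G.induce (R : Set V))
  obtain ⟨b, hb, hba⟩ := Finset.exists_mem_ne (s := R) (by omega) (a : V)
  by_cases hnil : p.Nil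
  -- If a longest path has no edge, `a` is isolated and any other node `b` can play the role of its
  -- neighbour.
  · refine ⟨a, a.2, b, hb, hba.symm, fun w hw _ _ hadj => ?_⟩
    have hadj' : (G.induce (R : Set V)).Adj a ⟨w, hw⟩ := hadj
    have h1 := hmax _ _ (SimpleGraph.Walk.cons hadj' .nil) (by
      simpa [SimpleGraph.Walk.cons_isPath_iff] using fun h => hadj'.ne h)
    have h2 := SimpleGraph.Walk.length_eq_zero_iff.mpr hnil
    simp [h2] at h1
  · have hsnd := p.adj_snd hnil
    refine ⟨a, a.2, p.snd, p.snd.2, fun h => hsnd.ne (Subtype.ext h), fun w hw _ hwu hadj => ?_⟩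
    have hadj' : (G.induce (R : Set V)).Adj a ⟨w, hw⟩ := hadj
    by_cases hs : (⟨w, hw⟩ : (R : Set V)) ∈ p.support
    · exact hwu (congrArg Subtype.val (hH.eq_snd_of_adj_start hp hadj' hs))
    · have h1 := hmax _ _ (SimpleGraph.Walk.cons hadj'.symm p) (by
        simpa [SimpleGraph.Walk.cons_isPath_iff] using ⟨hp, hs⟩)
      simp at h1

/-! ### Coverage functions on a forest -/

namespace WMC

open Finset

/-- `f S` is the weight of what the nodes in `S` cover, when only pairs of nodes overlap and `c`
holds the weights of the overlaps. -/
structure PairwiseCoverage (M : ℕ) (c : ℕ → ℕ → ℝ) (f : Finset ℕ → ℝ) : Prop where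
  nonneg : ∀ a b, 0 ≤ c a b
  symm : ∀ a b, c a b = c b a
  empty : f ∅ = 0
  singleton : ∀ a, f {a} = c a a
  union : ∀ A B, Disjoint A B → f (A ∪ B) = f A + f B - ∑ a ∈ A, ∑ b ∈ B, c a b
  forest : ∀ R ⊆ range M, 2 ≤ R.card →
    ∃ v ∈ R, ∃ u ∈ R, v ≠ u ∧ ∀ w ∈ R, w ≠ v → w ≠ u → c v w = 0

/-- The subsets of the block `D` with root `u` that an entry of the table stands for: `b` tells
whether the root is taken, and at most `g` other nodes are. -/
def Admissible (D : Finset ℕ) (u b g : ℕ) (S : Finset ℕ) : Prop :=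
  S ⊆ D ∧ (u ∈ S ↔ b = 1) ∧ (S.erase u).card ≤ g

/-- `F` is the value and `σ` the indicator function of an admissible set which is at least as good
as the admissible sets in the class `C`. -/
def Entry (M : ℕ) (f : Finset ℕ → ℝ) (C : Finset ℕ → Prop) (D : Finset ℕ) (u b g : ℕ) (F : ℝ)
    (σ : ℕ → ℕ) : Prop :=
  ∃ S, Admissible D u b g S ∧ F = f S ∧ (∀ l < M, σ l = if l ∈ S then 1 else 0) ∧
    ∀ T, Admissible D u b g T → C T → f T ≤ F

variable {M : ℕ} {c : ℕ → ℕ → ℝ} {f : Finset ℕ → ℝ}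

theorem Entry.mono {C C' : Finset ℕ → Prop} {D : Finset ℕ} {u b g : ℕ} {F : ℝ} {σ : ℕ → ℕ}
    (h : Entry M f C D u b g F σ) (hC : ∀ T, Admissible D u b g T → C' T → C T) :
    Entry M f C' D u b g F σ := by
  obtain ⟨S, hS, hF, hσ, hmax⟩ := h
  exact ⟨S, hS, hF, hσ, fun T hT hT' => hmax T hT (hC T hT hT')⟩

theorem Entry.congr {C : Finset ℕ → Prop} {D : Finset ℕ} {u b g : ℕ} {F F' : ℝ} {σ σ' : ℕ → ℕ}
    (h : Entry M f C D u b g F σ) (hF : F' = F) (hσ : ∀ l < M, σ' l = σ l) :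
    Entry M f C D u b g F' σ' := by
  obtain ⟨S, hS, hF', hσ', hmax⟩ := h
  exact ⟨S, hS, hF.trans hF', fun l hl => (hσ l hl).trans (hσ' l hl), by rwa [hF]⟩

/-- The larger of two candidate values dominates both classes of competitors. This is the maximum in
the recursion. -/
theorem Entry.or {C C' : Finset ℕ → Prop} {D : Finset ℕ} {u b g : ℕ} {F F' : ℝ} {σ σ' : ℕ → ℕ}
    (h : Entry M f C D u b g F σ) (h' : Entry M f C' D u b g F' σ') (hle : F ≤ F') :
    Entry M f (fun T => C T ∨ C' T) D u b g F' σ' := by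
  obtain ⟨S, hS, hF, hσ, hmax⟩ := h
  obtain ⟨S', hS', hF', hσ', hmax'⟩ := h'
  exact ⟨S', hS', hF', hσ', fun T hT hC => hC.elim (fun hC => (hmax T hT hC).trans hle)
    (fun hC => hmax' T hT hC)⟩

/-- A competitor that takes nothing from `E` already lies in `D`. Hence the old entry of the parent
is a correct starting value for the merge, the case where `E` receives no budget. -/
theorem Entry.union_right {D E : Finset ℕ} {u b g : ℕ} {F : ℝ} {σ : ℕ → ℕ}
    (h : Entry M f (fun _ => True) D u b g F σ) :
    Entry M f (fun T => (T ∩ E).card ≤ 0) (D ∪ E) u b g F σ := by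
  obtain ⟨S, hS, hF, hσ, hmax⟩ := h
  refine ⟨S, ⟨hS.1.trans subset_union_left, hS.2⟩, hF, hσ, fun T hT hC => ?_⟩
  refine hmax T ⟨fun a ha => ?_, hT.2⟩ trivial
  rcases mem_union.mp (hT.1 ha) with h | h
  · exact h
  · have : a ∈ T ∩ E := mem_inter.mpr ⟨ha, h⟩
    rw [card_eq_zero.mp (Nat.le_zero.mp hC)] at this
    simp at this

/-- Only the pair of roots can contribute, and it does so exactly when both are taken; for digits in
$\{0,1\}$ this is the product of the digits. -/
theorem sum_cross {D E S T : Finset ℕ} {u v b b' : ℕ} (hb : b ≤ 1) (hb' : b' ≤ 1)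
    (hcross : ∀ a ∈ D, ∀ d ∈ E, c a d ≠ 0 → a = u ∧ d = v) (hS : S ⊆ D) (hT : T ⊆ E)
    (hu : u ∈ S ↔ b = 1) (hv : v ∈ T ↔ b' = 1) :
    ∑ a ∈ S, ∑ d ∈ T, c a d = b * b' * c u v := by
  have h : ∀ a ∈ S, ∀ d ∈ T, c a d = if a = u then (if d = v then c u v else 0) else 0 := by
    intro a ha d hd
    by_cases h0 : c a d = 0
    · split_ifs with h1 h2
      · rw [← h1, ← h2, h0]
      · exact h0
      · exact h0
    · obtain ⟨h1, h2⟩ := hcross a (hS ha) d (hT hd) h0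
      rw [if_pos h1, if_pos h2, h1, h2]
  rw [sum_congr rfl fun a ha => sum_congr rfl (h a ha)]
  have h1 : ∀ a, (∑ d ∈ T, if a = u then (if d = v then c u v else 0) else 0) =
      if a = u then (b' : ℝ) * c u v else 0 := by
    intro a
    split_ifs
    · rw [sum_ite_eq']
      rcases (by omega : b' = 0 ∨ b' = 1) with rfl | rfl <;> simp [hv]
    · simp
  simp only [h1, sum_ite_eq']
  rcases (by omega : b = 0 ∨ b = 1) with rfl | rfl <;> simp [hu]

/-- The step of the dynamic program: an entry of the block `D` and an entry of the block `E` yield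
an entry of their union. -/
theorem Entry.combine (hf : PairwiseCoverage M c f) {D E : Finset ℕ} {u v b b' g h : ℕ}
    {F F' : ℝ} {σ σ' : ℕ → ℕ} (hb : b ≤ 1) (hb' : b' ≤ 1) (hh : 1 ≤ h) (hhg : h ≤ g)
    (hu : u ∈ D) (hv : v ∈ E) (hdisj : Disjoint D E)
    (hcross : ∀ a ∈ D, ∀ d ∈ E, c a d ≠ 0 → a = u ∧ d = v)
    (h1 : Entry M f (fun _ => True) D u b (g - h) F σ)
    (h2 : Entry M f (fun _ => True) E v b' (h - b') F' σ') :
    Entry M f (fun T => (v ∈ T ↔ b' = 1) ∧ (T ∩ E).card = h) (D ∪ E) u b g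
      (F + F' - b * b' * c u v) (fun l => σ l + σ' l) := by
  obtain ⟨S, ⟨hSD, hSu, hSc⟩, hF, hσ, hmax⟩ := h1
  obtain ⟨S', ⟨hSE, hSv, hSc'⟩, hF', hσ', hmax'⟩ := h2
  have huE : u ∉ E := fun h => disjoint_left.mp hdisj hu h
  have hvD : v ∉ D := fun h => disjoint_left.mp hdisj h hv
  have hSS : Disjoint S S' := disjoint_of_subset_left hSD (disjoint_of_subset_right hSE hdisj)
  have huS' : u ∉ S' := fun h => huE (hSE h)
  refine ⟨S ∪ S', ⟨union_subset_union hSD hSE, by simp [huS', hSu], ?_⟩, ?_, ?_, ?_⟩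
  -- The budget `h - b'` of the second entry leaves out its root; with the root included, the set
  -- has at most `h` nodes. All of them count against `g`, since `u` is not in `E`.
  · have hc : S'.card ≤ h := by
      by_cases hvS : v ∈ S'
      · have := hSv.mp hvS
        rw [card_erase_of_mem hvS] at hSc'
        omega
      · rw [erase_eq_of_notMem hvS] at hSc'
        omega
    rw [erase_union_distrib, erase_eq_of_notMem huS']
    exact (card_union_le _ _).trans (by omega)
  · rw [hf.union _ _ hSS, sum_cross hb hb' hcross hSD hSE hSu hSv, hF, hF']
  · intro l hl
    simp only [hσ l hl, hσ' l hl, mem_union]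
    by_cases h1 : l ∈ S
    · have := disjoint_left.mp hSS h1
      simp [h1, this]
    · simp [h1]
  · rintro T ⟨hTD, hTu, hTc⟩ ⟨hTv, hTh⟩
    -- Optimality: a competitor splits into its traces on the two blocks, each admissible for the
    -- corresponding entry. The correction depends only on the digits, so it is the same for the
    -- competitor and for the combined set.
    have hsplit : T ∩ D ∪ T ∩ E = T := by
      rw [← inter_union_distrib_left]; exact inter_eq_left.mpr hTD
    have hTT : Disjoint (T ∩ D) (T ∩ E) :=
      disjoint_of_subset_left inter_subset_right (disjoint_of_subset_right inter_subset_right hdisj)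
    have hu1 : u ∈ T ∩ D ↔ b = 1 := by simp [hu, hTu]
    have hv1 : v ∈ T ∩ E ↔ b' = 1 := by simp [hv, hTv]
    have hA : ((T ∩ D).erase u).card ≤ g - h := by
      have : (T.erase u) = (T ∩ D).erase u ∪ T ∩ E := by
        conv_lhs => rw [← hsplit]
        rw [erase_union_distrib, erase_eq_of_notMem (s := T ∩ E) (by simp [huE])]
      rw [this, card_union_of_disjoint (disjoint_of_subset_left (erase_subset _ _) hTT)] at hTc
      omega
    have hB : ((T ∩ E).erase v).card ≤ h - b' := by
      by_cases hvT : v ∈ T ∩ E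
      · rw [card_erase_of_mem hvT, hv1.mp hvT]; omega
      · have : b' ≠ 1 := fun h => hvT (hv1.mpr h)
        rw [erase_eq_of_notMem hvT]; omega
    have e1 := hmax _ ⟨inter_subset_right, hu1, hA⟩ trivial
    have e2 := hmax' _ ⟨inter_subset_right, hv1, hB⟩ trivial
    have e3 := hf.union _ _ hTT
    rw [hsplit, sum_cross hb hb' hcross inter_subset_right inter_subset_right hu1 hv1] at e3
    rw [e3]
    linarith

/-- `B` partitions the nodes into one block for each root in `R`, and distinct blocks overlap in
their roots only. -/
structure Blocks (M : ℕ) (c : ℕ → ℕ → ℝ) (R : Finset ℕ) (B : ℕ → Finset ℕ) : Prop where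
  root_mem : ∀ v ∈ R, v ∈ B v
  subset : ∀ v ∈ R, B v ⊆ range M
  disjoint : ∀ v ∈ R, ∀ w ∈ R, v ≠ w → Disjoint (B v) (B w)
  cross : ∀ v ∈ R, ∀ w ∈ R, v ≠ w → ∀ a ∈ B v, ∀ b ∈ B w, c a b ≠ 0 → a = v ∧ b = w
  cover : ∀ l < M, ∃ v ∈ R, l ∈ B v

theorem blocks_singleton : Blocks M c (range M) (fun v => {v}) where
  root_mem := by simp
  subset := by simp
  disjoint := by simp
  cross := by simp +contextual
  cover := by simp

/-- `v` and `u` are nodes in `R`, and no other node in `R` than `u` overlaps with `v`. -/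
def IsLeaf (c : ℕ → ℕ → ℝ) (R : Finset ℕ) (v u : ℕ) : Prop :=
  v ∈ R ∧ u ∈ R ∧ v ≠ u ∧ ∀ w ∈ R, w ≠ v → w ≠ u → c v w = 0

/-- Every overlap of the block of `v` with another block goes through `v` to the other root. As `v`
is a leaf, that root can only be `u`, so after the merge `u` is the only contact of the enlarged
block with the rest. -/
theorem Blocks.merge {R : Finset ℕ} {B : ℕ → Finset ℕ} {v u : ℕ} (hB : Blocks M c R B)
    (hsymm : ∀ a b, c a b = c b a) (hl : IsLeaf c R v u) :
    Blocks M c (R.erase v) (Function.update B u (B u ∪ B v)) := by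
  obtain ⟨hv, hu, hvu, hleaf⟩ := hl
  constructor
  · intro w hw
    have ⟨hwv, hw⟩ := mem_erase.mp hw
    by_cases h : w = u
    · subst h; simp [hB.root_mem w hw]
    · simp [h, hB.root_mem w hw]
  · intro w hw
    have ⟨hwv, hw⟩ := mem_erase.mp hw
    by_cases h : w = u
    · subst h; simpa using union_subset (hB.subset w hw) (hB.subset v hv)
    · simpa [h] using hB.subset w hw
  · intro w hw z hz hwz
    have ⟨hwv, hw⟩ := mem_erase.mp hw
    have ⟨hzv, hz⟩ := mem_erase.mp hz
    by_cases h : w = u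
    · subst h
      simp only [Function.update_self, Function.update_of_ne hwz.symm, disjoint_union_left]
      exact ⟨hB.disjoint _ hw _ hz hwz, hB.disjoint _ hv _ hz hzv.symm⟩
    · by_cases h' : z = u
      · subst h'
        simp only [Function.update_self, Function.update_of_ne hwz, disjoint_union_right]
        exact ⟨hB.disjoint _ hw _ hz hwz, hB.disjoint _ hw _ hv hwv⟩
      · simp only [Function.update_of_ne h, Function.update_of_ne h']
        exact hB.disjoint _ hw _ hz hwz
  · intro w hw z hz hwz a ha d hd hne
    have ⟨hwv, hw'⟩ := mem_erase.mp hw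
    have ⟨hzv, hz'⟩ := mem_erase.mp hz
    by_cases h : w = u
    · subst h
      simp only [Function.update_self, Function.update_of_ne hwz.symm, mem_union] at ha hd
      rcases ha with ha | ha
      · exact hB.cross _ hw' _ hz' hwz _ ha _ hd hne
      · obtain ⟨rfl, rfl⟩ := hB.cross _ hv _ hz' hzv.symm _ ha _ hd hne
        exact absurd (hleaf _ hz' hzv hwz.symm) hne
    · by_cases h' : z = u
      · subst h'
        simp only [Function.update_self, Function.update_of_ne hwz, mem_union] at ha hd
        rcases hd with hd | hd
        · exact hB.cross _ hw' _ hz' hwz _ ha _ hd hne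
        · obtain ⟨rfl, rfl⟩ := hB.cross _ hw' _ hv hwv _ ha _ hd hne
          rw [hsymm] at hne
          exact absurd (hleaf _ hw' hwv h) hne
      · simp only [Function.update_of_ne h, Function.update_of_ne h'] at ha hd
        exact hB.cross _ hw' _ hz' hwz _ ha _ hd hne
  · intro l hl
    obtain ⟨w, hw, hlw⟩ := hB.cover l hl
    by_cases h : w = v
    · subst h
      exact ⟨u, mem_erase.mpr ⟨hvu.symm, hu⟩, by simp [hlw]⟩
    · refine ⟨w, mem_erase.mpr ⟨h, hw⟩, ?_⟩
      by_cases h' : w = u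
      · subst h'; simp [hlw]
      · simpa [h'] using hlw

/-! ### The coverage function of a group structure -/

variable {N : ℕ}

/-- The groups, indexed by all natural numbers. -/
def groupAt (𝔊 : GroupStructure N M) (j : ℕ) : Finset (Fin N) :=
  if h : j < M then 𝔊.group ⟨j, h⟩ else ∅

/-- The weight of the intersection of two groups. -/
noncomputable def overlap (𝔊 : GroupStructure N M) (x : Fin N → ℝ) (a b : ℕ) : ℝ :=
  ∑ i ∈ groupAt 𝔊 a ∩ groupAt 𝔊 b, x i ^ 2

/-- The weight of the union of a set of groups. -/
noncomputable def coverage (𝔊 : GroupStructure N M) (x : Fin N → ℝ) (S : Finset ℕ) : ℝ :=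
  ∑ i ∈ S.biUnion (groupAt 𝔊), x i ^ 2

theorem mem_groupAt {𝔊 : GroupStructure N M} {i : Fin N} {j : ℕ} :
    i ∈ groupAt 𝔊 j ↔ ∃ h : j < M, i ∈ 𝔊.group ⟨j, h⟩ := by
  unfold groupAt
  split_ifs with h <;> simp [h]

theorem not_mem_three_groups {𝔊 : GroupStructure N M}
    (h : ∀ i : Fin N, (univ.filter fun j : Fin M => i ∈ 𝔊.group j).card ≤ 2)
    {i : Fin N} {a b d : ℕ} (hab : a ≠ b) (had : a ≠ d) (hbd : b ≠ d)
    (ha : i ∈ groupAt 𝔊 a) (hb : i ∈ groupAt 𝔊 b) : i ∉ groupAt 𝔊 d := by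
  intro hd
  obtain ⟨ha, ha'⟩ := mem_groupAt.mp ha
  obtain ⟨hb, hb'⟩ := mem_groupAt.mp hb
  obtain ⟨hd, hd'⟩ := mem_groupAt.mp hd
  have hsub : ({⟨a, ha⟩, ⟨b, hb⟩, ⟨d, hd⟩} : Finset (Fin M)) ⊆
      univ.filter fun j : Fin M => i ∈ 𝔊.group j := by
    intro j hj
    simp only [mem_insert, mem_singleton] at hj
    rcases hj with rfl | rfl | rfl <;> simpa
  have h3 : ({⟨a, ha⟩, ⟨b, hb⟩, ⟨d, hd⟩} : Finset (Fin M)).card = 3 :=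
    card_eq_three.mpr ⟨_, _, _, by simpa using hab, by simpa using had, by simpa using hbd, rfl⟩
  have := card_le_card hsub
  have := h i
  omega

/-- The intersection of the two unions is the union of the sets $\mathcal G_a\cap\mathcal G_b$ with
$a\in A$, $b\in B$. These are pairwise disjoint, so the weight of the intersection is the double
sum. -/
theorem coverage_union {𝔊 : GroupStructure N M} (x : Fin N → ℝ)
    (h : ∀ i : Fin N, (univ.filter fun j : Fin M => i ∈ 𝔊.group j).card ≤ 2)
    (A B : Finset ℕ) (hAB : Disjoint A B) :
    coverage 𝔊 x (A ∪ B) =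
      coverage 𝔊 x A + coverage 𝔊 x B - ∑ a ∈ A, ∑ b ∈ B, overlap 𝔊 x a b := by
  have hinter : A.biUnion (groupAt 𝔊) ∩ B.biUnion (groupAt 𝔊) =
      (A ×ˢ B).biUnion fun p => groupAt 𝔊 p.1 ∩ groupAt 𝔊 p.2 := by
    ext i
    simp only [mem_inter, mem_biUnion, mem_product, Prod.exists]
    constructor
    · rintro ⟨⟨a, ha, hia⟩, b, hb, hib⟩
      exact ⟨a, b, ⟨ha, hb⟩, hia, hib⟩
    · rintro ⟨a, b, ⟨ha, hb⟩, hia, hib⟩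
      exact ⟨⟨a, ha, hia⟩, b, hb, hib⟩
  have hsum : ∑ a ∈ A, ∑ b ∈ B, overlap 𝔊 x a b =
      ∑ i ∈ A.biUnion (groupAt 𝔊) ∩ B.biUnion (groupAt 𝔊), x i ^ 2 := by
    rw [hinter, sum_biUnion, sum_product]
    · rfl
    -- Two distinct pairs from `A ×ˢ B` involve at least three distinct groups, because `A` and `B`
    -- are disjoint.
    · rintro ⟨a, b⟩ hp ⟨a', b'⟩ hp' hne
      simp only [coe_product, Set.mem_prod, mem_coe] at hp hp'
      refine disjoint_left.mpr fun i hi hi' => ?_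
      simp only [mem_inter] at hi hi'
      have n1 : a ≠ b := fun h => disjoint_left.mp hAB hp.1 (h ▸ hp.2)
      have n2 : a ≠ b' := fun h => disjoint_left.mp hAB hp.1 (h ▸ hp'.2)
      have n3 : a' ≠ b := fun h => disjoint_left.mp hAB hp'.1 (h ▸ hp.2)
      by_cases haa : a = a'
      · have hbb : b ≠ b' := fun h => hne (by rw [haa, h])
        exact not_mem_three_groups h n1 n2 hbb hi.1 hi.2 hi'.2
      · exact not_mem_three_groups h n1 haa n3.symm hi.1 hi.2 hi'.1
  rw [hsum]
  unfold coverage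
  rw [union_biUnion, ← sum_union_inter]
  ring

/-- Acyclicity enters only through the existence of a leaf in each set of at least two groups:
distinct non-adjacent groups are disjoint, so their overlap has weight zero. Intersecting groups may
also have overlap zero, where `x` vanishes; this does no harm. -/
theorem pairwiseCoverage {𝔊 : GroupStructure N M} (h : 𝔊.LooplessPairwiseOverlapping)
    (x : Fin N → ℝ) : PairwiseCoverage M (overlap 𝔊 x) (coverage 𝔊 x) where
  nonneg a b := sum_nonneg fun _ _ => sq_nonneg _
  symm a b := by unfold overlap; rw [inter_comm]
  empty := by simp [coverage]
  singleton a := by simp [coverage, overlap]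
  union := coverage_union x h.1
  forest := by
    intro R hR hcard
    have hM : ∀ a ∈ R, a < M := fun a ha => by simpa using hR ha
    obtain ⟨v, hv, u, hu, hvu, hleaf⟩ :=
      h.2.exists_mem_forall_not_adj (R.attachFin hM) (by rwa [card_attachFin])
    rw [mem_attachFin] at hv hu
    refine ⟨v, hv, u, hu, fun h => hvu (Fin.ext h), fun w hw hwv hwu => ?_⟩
    have hn := hleaf ⟨w, hM w hw⟩ (by simpa using hw) (fun h => hwv (congrArg Fin.val h))
      (fun h => hwu (congrArg Fin.val h))
    have he : 𝔊.group v ∩ 𝔊.group ⟨w, hM w hw⟩ = ∅ := by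
      by_contra hne
      exact hn ⟨fun h => hwv (congrArg Fin.val h).symm, nonempty_iff_ne_empty.mpr hne⟩
    simp [overlap, groupAt, hM w hw, he]

end WMC

/-! ### Tables -/

namespace WMC

open RealRAM RealRAM.ForProgram Finset

/-- The equality test. -/
abbrev natEq (e₁ e₂ : NatExpr) : Test := .and (.natLe e₁ e₂) (.natLe e₂ e₁)

/-- Cell of the entry `g` of the row `p`, in an array with rows of length `M + 1`. -/
def rowCell (M p g : ℕ) : ℕ := p * (M + 1) + g

/-- Cell of the entry `l` of the row `g` of the slab `p`, in an array with square slabs of size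
`M + 1`. -/
def slabCell (M p g l : ℕ) : ℕ := p * ((M + 1) * (M + 1)) + g * (M + 1) + l

/-- Since `g ≤ M`, the row and the entry are quotient and remainder modulo `M + 1`. -/
theorem rowCell_inj {M p g p' g' : ℕ} (hg : g ≤ M) (hg' : g' ≤ M) :
    rowCell M p g = rowCell M p' g' ↔ p = p' ∧ g = g' := by
  refine ⟨fun h => ?_, fun h => by rw [h.1, h.2]⟩
  unfold rowCell at h
  have h1 : g = g' := by
    simpa [Nat.mod_eq_of_lt (Nat.lt_succ_of_le hg), Nat.mod_eq_of_lt (Nat.lt_succ_of_le hg')]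
      using congrArg (· % (M + 1)) h
  subst h1
  exact ⟨Nat.eq_of_mul_eq_mul_right (Nat.succ_pos M) (Nat.add_right_cancel h), rfl⟩

theorem slabCell_inj {M p g l p' g' l' : ℕ} (hg : g ≤ M) (hg' : g' ≤ M) (hl : l ≤ M)
    (hl' : l' ≤ M) : slabCell M p g l = slabCell M p' g' l' ↔ p = p' ∧ g = g' ∧ l = l' := by
  have h : ∀ p g l, slabCell M p g l = rowCell M (rowCell M p g) l := by
    intros; unfold slabCell rowCell; ring
  rw [h, h, rowCell_inj hl hl', rowCell_inj hg hg', and_assoc]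

/-- Address of the entry `g` of the row `p`; the array `4` holds the multiples of the length of a
row. -/
abbrev rowExpr (p g : NatExpr) : NatExpr := .add (.load 4 p) g

/-- Address of the entry `l` of the row `g` of the slab `p`; the array `5` holds the multiples of
the size of a slab. -/
abbrev slabExpr (p g l : NatExpr) : NatExpr := .add (.add (.load 5 p) (.load 4 g)) l

/-- Fills the array `a` with the multiples of the value of `e`. -/
def multiples (a k n : ℕ) (e : NatExpr) : ForProgram :=
  .forLoop k n (.setNat a (.add (reg k) (.lit 1)) (.add (.load a (reg k)) e))

/-- The machine cannot multiply natural numbers, so multiples are accumulated by repeated addition;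
`he` says that the summand keeps the value `w` throughout the loop. -/
theorem multiples_spec {a k n w : ℕ} {e : NatExpr} {s : Store} (hak : k ≠ a)
    (h0 : s.nat a 0 = 0) (he : ∀ s' : Store, (∀ b, b ≠ a → b ≠ k → s'.nat b = s.nat b) →
      e.value s' = w) :
    ∀ i ≤ s.nat 0 n, ((multiples a k n e).eval s).nat a i = i * w := by
  refine eval_forLoop_induction (fun m s' => ∀ i ≤ m, s'.nat a i = i * w) ?_ ?_ ?_
  · intro i s' v h j hj
    rw [nat_setNat_of_ne _ _ _ hak.symm]
    exact h j hj
  · intro i hi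
    rw [Nat.le_zero.mp hi, h0, Nat.zero_mul]
  · intro m _ s' hn _ hk h i hi
    have hv : e.value s' = w :=
      he s' fun b hb hbk => hn b (by simp [natWrites, hb, hbk])
    simp only [eval, value_add, value_load, value_lit, nat_setNat, hk, hv, true_and]
    split_ifs with hi'
    · rw [hi', h m le_rfl]; ring
    · exact h i (by omega)

/-! ### The weights of the overlaps -/

variable {N M : ℕ}

/-- What the program knows of the group structure and the signal: sizes, rows of tables, the
bi-adjacency matrix with the starts of its rows in the array `6`, and the signal. -/
structure InputReady (𝔊 : GroupStructure N M) (x : Fin N → ℝ) (s : Store) : Prop where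
  card_variables : s.nat 0 0 = N
  card_groups : s.nat 0 1 = M
  row : ∀ i ≤ 2 * (M + 1), s.nat 4 i = i * (M + 1)
  incidence : ∀ (i : Fin N), ∀ j < M,
    s.nat 1 (s.nat 6 i + j) = if i ∈ groupAt 𝔊 j then 1 else 0
  signal : ∀ i : Fin N, s.real 0 i = x i

theorem InputReady.frame {𝔊 : GroupStructure N M} {x : Fin N → ℝ} {s s' : Store}
    (h : InputReady 𝔊 x s) {L L' : List ℕ} (hn : ∀ a, a ∉ L → s'.nat a = s.nat a)
    (hr : ∀ a, a ∉ L' → s'.real a = s.real a) (hL : ∀ a ∈ [0, 1, 4, 6], a ∉ L)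
    (hL' : 0 ∉ L') : InputReady 𝔊 x s' := by
  have h0 := hn 0 (hL 0 (by decide))
  have h1 := hn 1 (hL 1 (by decide))
  have h4 := hn 4 (hL 4 (by decide))
  have h6 := hn 6 (hL 6 (by decide))
  have r0 := hr 0 hL'
  exact ⟨by rw [h0, h.card_variables], by rw [h0, h.card_groups], by rw [h4]; exact h.row,
    by rw [h1, h6]; exact h.incidence, by rw [r0]; exact h.signal⟩

/-- Tests whether the variable in register `i` lies in the group in register `j`. -/
abbrev incidenceTest (i j : ℕ) : Test :=
  .natLe (.lit 1) (.load 1 (.add (.load 6 (reg i)) (reg j)))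

theorem holds_incidenceTest {𝔊 : GroupStructure N M} {x : Fin N → ℝ} {s : Store}
    (h : InputReady 𝔊 x s) {i j a : ℕ} (k : Fin N) (hi : s.nat i 0 = k) (hj : s.nat j 0 = a)
    (ha : a < M) : (incidenceTest i j).Holds s ↔ k ∈ groupAt 𝔊 a := by
  simp only [holds_natLe, value_lit, value_load, value_add, hi, hj, h.incidence k a ha]
  split_ifs with hm <;> simp [hm]

/-- Adds to entry `(a, b)` of the table in the real array `1` the weight of an overlap. -/
def overlapCell : ForProgram :=
  .forLoop 22 0 (.ite (.and (incidenceTest 22 20) (incidenceTest 22 21))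
    (.setReal 1 (rowExpr (reg 20) (reg 21)) (.add (.load 1 (rowExpr (reg 20) (reg 21)))
      (.mul (.load 0 (reg 22)) (.load 0 (reg 22))))) .skip)

/-- Does so for one row. -/
def overlapRow : ForProgram := .forLoop 21 1 overlapCell

/-- Does so for the whole table. -/
def overlapTable : ForProgram := .forLoop 20 1 overlapRow

theorem overlapCell_spec {𝔊 : GroupStructure N M} {x : Fin N → ℝ} {s : Store}
    (h : InputReady 𝔊 x s) {a b : ℕ} (ha : s.nat 20 0 = a) (hb : s.nat 21 0 = b) (haM : a < M)
    (hbM : b < M) : ∀ a' < M, ∀ b' < M, (overlapCell.eval s).real 1 (rowCell M a' b') =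
      s.real 1 (rowCell M a' b') + if a' = a ∧ b' = b then overlap 𝔊 x a' b' else 0 := by
  have key := eval_forLoop_induction (k := 22) (n := 0) (s := s)
    (c := .ite (.and (incidenceTest 22 20) (incidenceTest 22 21))
      (.setReal 1 (rowExpr (reg 20) (reg 21)) (.add (.load 1 (rowExpr (reg 20) (reg 21)))
        (.mul (.load 0 (reg 22)) (.load 0 (reg 22))))) .skip)
    (fun m s' => ∀ a' < M, ∀ b' < M, s'.real 1 (rowCell M a' b') =
      s.real 1 (rowCell M a' b') + if a' = a ∧ b' = b then
        ∑ i ∈ (groupAt 𝔊 a' ∩ groupAt 𝔊 b').filter (fun i : Fin N => (i : ℕ) < m), x i ^ 2 else 0)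
    (fun i s' v hP => hP) (by simp) ?_
  · intro a' ha' b' hb'
    have := key a' ha' b' hb'
    rw [h.card_variables] at this
    simpa [overlap, overlapCell] using this
  · intro m hm s' hn hr hk hP a' ha' b' hb'
    rw [h.card_variables] at hm
    have hs' : InputReady 𝔊 x s' := h.frame hn hr (by decide) (by decide)
    have h20 : s'.nat 20 0 = a := by rw [hn 20 (by decide), ha]
    have h21 : s'.nat 21 0 = b := by rw [hn 21 (by decide), hb]
    -- Raising the cut-off from `m` to `m + 1` admits just the index `m`.
    have hfilter : ∀ T : Finset (Fin N), ∑ i ∈ T.filter (fun i : Fin N => (i : ℕ) < m + 1), x i ^ 2 =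
        ∑ i ∈ T.filter (fun i : Fin N => (i : ℕ) < m), x i ^ 2 +
          if (⟨m, hm⟩ : Fin N) ∈ T then x ⟨m, hm⟩ ^ 2 else 0 := by
      intro T
      have h1 : T.filter (fun i : Fin N => (i : ℕ) < m + 1) =
          T.filter (fun i : Fin N => (i : ℕ) < m) ∪ T.filter (fun i : Fin N => i = ⟨m, hm⟩) := by
        ext i
        simp only [mem_filter, mem_union, Fin.ext_iff]
        constructor
        · rintro ⟨h1, h2⟩
          rcases Nat.lt_succ_iff_lt_or_eq.mp h2 with h3 | h3
          exacts [Or.inl ⟨h1, h3⟩, Or.inr ⟨h1, h3⟩]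
        · rintro (⟨h1, h2⟩ | ⟨h1, h2⟩) <;> exact ⟨h1, by omega⟩
      rw [h1, sum_union, Finset.filter_eq']
      · split_ifs <;> simp
      · refine disjoint_filter.mpr fun i _ h1 h2 => ?_
        rw [h2] at h1
        exact lt_irrefl _ h1
    simp only [eval, holds_and,
      holds_incidenceTest hs' ⟨m, hm⟩ hk h20 haM, holds_incidenceTest hs' ⟨m, hm⟩ hk h21 hbM]
    have hsq : s'.real 0 m = x ⟨m, hm⟩ := hs'.signal ⟨m, hm⟩
    have hrow : s'.nat 4 a + b = rowCell M a b := by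
      rw [hs'.row a (by omega)]; rfl
    split_ifs with hmem hab hab
    · obtain ⟨rfl, rfl⟩ := hab
      have h1 := hP a' ha' b' hb'
      rw [if_pos ⟨rfl, rfl⟩] at h1
      simp only [realValue_add, realValue_mul, realValue_load, value_add, value_load, value_lit,
        real_setReal, h20, h21, hk, hrow, hsq, true_and, if_true, h1]
      rw [hfilter, if_pos (by simpa using hmem)]
      ring
    · have h1 := hP a' ha' b' hb'
      rw [if_neg hab] at h1
      simp only [realValue_add, realValue_mul, realValue_load, value_add, value_load, value_lit,
        real_setReal, h20, h21, hk, hrow, rowCell_inj hb'.le hbM.le, if_neg hab, h1, true_and]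
    · rw [hfilter, if_neg, add_zero]
      · have h1 := hP a' ha' b' hb'
        rwa [if_pos hab] at h1
      · rw [hab.1, hab.2]; simpa using hmem
    · have h1 := hP a' ha' b' hb'
      rwa [if_neg hab] at h1

theorem overlapRow_spec {𝔊 : GroupStructure N M} {x : Fin N → ℝ} {s : Store}
    (h : InputReady 𝔊 x s) {a : ℕ} (ha : s.nat 20 0 = a) (haM : a < M) :
    ∀ a' < M, ∀ b' < M, (overlapRow.eval s).real 1 (rowCell M a' b') =
      s.real 1 (rowCell M a' b') + if a' = a then overlap 𝔊 x a' b' else 0 := by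
  have key := eval_forLoop_induction (k := 21) (n := 1) (s := s) (c := overlapCell)
    (fun m s' => ∀ a' < M, ∀ b' < M, s'.real 1 (rowCell M a' b') =
      s.real 1 (rowCell M a' b') + if a' = a ∧ b' < m then overlap 𝔊 x a' b' else 0)
    (fun i s' v hP => hP) (by simp) ?_
  · intro a' ha' b' hb'
    have := key a' ha' b' hb'
    rw [h.card_groups] at this
    simpa [hb', overlapRow] using this
  · intro m hm s' hn hr hk hP a' ha' b' hb'
    rw [h.card_groups] at hm
    have hs' : InputReady 𝔊 x s' := h.frame hn hr (by decide) (by decide)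
    have h20 : s'.nat 20 0 = a := by rw [hn 20 (by decide), ha]
    rw [overlapCell_spec hs' h20 hk haM hm a' ha' b' hb', hP a' ha' b' hb']
    by_cases h1 : a' = a <;> by_cases h2 : b' = m
    · simp [h1, h2]
    · have : b' < m + 1 ↔ b' < m := by omega
      simp [h1, h2, this]
    · simp [h1]
    · simp [h1]

theorem overlapTable_spec {𝔊 : GroupStructure N M} {x : Fin N → ℝ} {s : Store}
    (h : InputReady 𝔊 x s) :
    ∀ a' < M, ∀ b' < M, (overlapTable.eval s).real 1 (rowCell M a' b') =
      s.real 1 (rowCell M a' b') + overlap 𝔊 x a' b' := by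
  have key := eval_forLoop_induction (k := 20) (n := 1) (s := s) (c := overlapRow)
    (fun m s' => ∀ a' < M, ∀ b' < M, s'.real 1 (rowCell M a' b') =
      s.real 1 (rowCell M a' b') + if a' < m then overlap 𝔊 x a' b' else 0)
    (fun i s' v hP => hP) (by simp) ?_
  · intro a' ha' b' hb'
    have := key a' ha' b' hb'
    rw [h.card_groups] at this
    simpa [ha', overlapTable] using this
  · intro m hm s' hn hr hk hP a' ha' b' hb'
    rw [h.card_groups] at hm
    have hs' : InputReady 𝔊 x s' := h.frame hn hr (by decide) (by decide)
    rw [overlapRow_spec hs' hk hm a' ha' b' hb', hP a' ha' b' hb']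
    by_cases h1 : a' = m
    · simp [h1]
    · have : a' < m + 1 ↔ a' < m := by omega
      simp [h1, this]

end WMC

/-! ### The dynamic program -/

namespace WMC

open RealRAM RealRAM.ForProgram Finset

variable {M : ℕ} {c : ℕ → ℕ → ℝ} {f : Finset ℕ → ℝ}

/-- What the dynamic program reads: sizes, the multiples that are needed for addresses, the weights
of the overlaps, and the real numbers `0` and `1`. -/
structure WeightsReady (M : ℕ) (c : ℕ → ℕ → ℝ) (s : Store) : Prop where
  card_groups : s.nat 0 1 = M
  row_length : s.nat 0 3 = M + 1
  two : s.nat 0 4 = 2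
  row : ∀ i ≤ 2 * (M + 1), s.nat 4 i = i * (M + 1)
  slab : ∀ i ≤ 2 * (M + 1), s.nat 5 i = i * ((M + 1) * (M + 1))
  weight : ∀ a < M, ∀ b < M, s.real 1 (rowCell M a b) = c a b
  digit : ∀ b ≤ 1, s.real 3 b = b

theorem WeightsReady.frame {s s' : Store} (h : WeightsReady M c s) {L L' : List ℕ}
    (hn : ∀ a, a ∉ L → s'.nat a = s.nat a) (hr : ∀ a, a ∉ L' → s'.real a = s.real a)
    (hL : ∀ a ∈ [0, 4, 5], a ∉ L) (hL' : ∀ a ∈ [1, 3], a ∉ L') : WeightsReady M c s' := by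
  have h0 := hn 0 (hL 0 (by decide))
  have h4 := hn 4 (hL 4 (by decide))
  have h5 := hn 5 (hL 5 (by decide))
  have r1 := hr 1 (hL' 1 (by decide))
  have r3 := hr 3 (hL' 3 (by decide))
  exact ⟨by rw [h0, h.card_groups], by rw [h0, h.row_length], by rw [h0, h.two],
    by rw [h4]; exact h.row, by rw [h5]; exact h.slab, by rw [r1]; exact h.weight,
    by rw [r3]; exact h.digit⟩

theorem WeightsReady.row_add {s : Store} (h : WeightsReady M c s) {p : ℕ} (hp : p ≤ 2 * (M + 1))
    (g : ℕ) : s.nat 4 p + g = rowCell M p g := by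
  rw [h.row p hp]; rfl

theorem WeightsReady.slab_add {s : Store} (h : WeightsReady M c s) {p g : ℕ}
    (hp : p ≤ 2 * (M + 1)) (hg : g ≤ M) (l : ℕ) :
    s.nat 5 p + s.nat 4 g + l = slabCell M p g l := by
  rw [h.slab p hp, h.row g (by omega)]; rfl

/-! ### The table in memory. -/

/-- The value in the table entry `(v, b, g)`. -/
def tableValue (M : ℕ) (s : Store) (v b g : ℕ) : ℝ := s.real 2 (rowCell M (v + v + b) g)

/-- The indicator function in the table entry `(v, b, g)`. -/
def tableSet (M : ℕ) (s : Store) (v b g l : ℕ) : ℕ := s.nat 7 (slabCell M (v + v + b) g l)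

/-- The table entry `(v, b, g)` is as it should be with respect to `C` and `D`. -/
def EntryAt (M : ℕ) (f : Finset ℕ → ℝ) (C : Finset ℕ → Prop) (D : Finset ℕ) (s : Store)
    (v b g : ℕ) : Prop :=
  Entry M f C D v b g (tableValue M s v b g) (tableSet M s v b g)

/-- Two stores have the same table entry `(v, b, g)`. -/
def SameAt (M : ℕ) (s s' : Store) (v b g : ℕ) : Prop :=
  tableValue M s' v b g = tableValue M s v b g ∧
    ∀ l < M, tableSet M s' v b g l = tableSet M s v b g l

theorem SameAt.refl (s : Store) (v b g : ℕ) : SameAt M s s v b g := ⟨rfl, fun _ _ => rfl⟩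

theorem SameAt.trans {s s' s'' : Store} {v b g : ℕ} (h : SameAt M s s' v b g)
    (h' : SameAt M s' s'' v b g) : SameAt M s s'' v b g :=
  ⟨h'.1.trans h.1, fun l hl => (h'.2 l hl).trans (h.2 l hl)⟩

theorem SameAt.entryAt {s s' : Store} {v b g : ℕ} (h : SameAt M s s' v b g)
    {C : Finset ℕ → Prop} {D : Finset ℕ} (he : EntryAt M f C D s v b g) :
    EntryAt M f C D s' v b g :=
  Entry.congr he h.1 h.2

theorem tableSet_setNat (s : Store) {a : ℕ} (i w v b g l : ℕ) (h : 7 ≠ a) :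
    tableSet M (s.setNat a i w) v b g l = tableSet M s v b g l := by
  unfold tableSet
  rw [nat_setNat_of_ne _ _ _ h]

theorem SameAt.setNat {s s' : Store} {v b g : ℕ} (h : SameAt M s s' v b g) {a : ℕ} (i w : ℕ)
    (ha : 7 ≠ a) : SameAt M s (s'.setNat a i w) v b g :=
  ⟨h.1, fun l hl => (tableSet_setNat s' i w v b g l ha).trans (h.2 l hl)⟩

theorem EntryAt.setNat {C : Finset ℕ → Prop} {D : Finset ℕ} {s : Store} {v b g : ℕ}
    (h : EntryAt M f C D s v b g) {a : ℕ} (i w : ℕ) (ha : 7 ≠ a) :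
    EntryAt M f C D (s.setNat a i w) v b g :=
  ((SameAt.refl s v b g).setNat i w ha).entryAt h

/-! ### Merging two blocks in place. -/

/-- The node in a register together with the digit in another one. -/
abbrev nodeExpr (v b : ℕ) : NatExpr := .add (.add (reg v) (reg v)) (reg b)

/-- The capacity of the current entry. -/
abbrev capacity : NatExpr := .sub (.load 0 (.lit 1)) (reg 25)

/-- The part of the capacity that goes to the other block. -/
abbrev part : NatExpr := .add (reg 26) (.lit 1)

/-- The rest of the capacity. -/
abbrev remainder : NatExpr := .sub capacity part

/-- The part without the root of the other block. -/
abbrev partBelow : NatExpr := .sub part (reg 27)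

/-- The value that results from combining two entries. -/
abbrev candidate : RealExpr :=
  .sub (.add (.load 2 (rowExpr (nodeExpr 22 24) remainder))
      (.load 2 (rowExpr (nodeExpr 21 27) partBelow)))
    (.mul (.mul (.load 3 (reg 24)) (.load 3 (reg 27))) (.load 1 (rowExpr (reg 22) (reg 21))))

/-- Adds the indicator functions of two sets at one place. -/
def copyCell : ForProgram :=
  .setNat 7 (slabExpr (nodeExpr 22 24) capacity (reg 28))
    (.add (.load 7 (slabExpr (nodeExpr 22 24) remainder (reg 28)))
      (.load 7 (slabExpr (nodeExpr 21 27) partBelow (reg 28))))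

/-- Stores the union of two sets. -/
def copySets : ForProgram := .forLoop 28 1 copyCell

/-- Improves an entry if the candidate is better. -/
def relax : ForProgram :=
  .ite (.and (.natLe part capacity)
      (.not (.realLe candidate (.load 2 (rowExpr (nodeExpr 22 24) capacity)))))
    (.seq (.setReal 2 (rowExpr (nodeExpr 22 24) capacity) candidate) copySets)
    .skip

/-- Considers both possibilities for the root of the other block. -/
def relaxBoth : ForProgram := .forLoop 27 4 relax

/-- Considers all distributions of the capacity. -/
def relaxAll : ForProgram := .forLoop 26 1 relaxBoth

/-- Updates the entries for all capacities, in decreasing order. -/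
def mergeRow : ForProgram := .forLoop 25 3 relaxAll

/-- Merges the block of the node in register `21` into the block of the node in register `22`. -/
def merge : ForProgram := .forLoop 24 4 mergeRow

/-- The contents of the registers in the innermost loop. -/
structure Registers (s : Store) (v u b i h b' : ℕ) : Prop where
  child : s.nat 21 0 = v
  parent : s.nat 22 0 = u
  digit : s.nat 24 0 = b
  index : s.nat 25 0 = i
  portion : s.nat 26 0 = h
  digit' : s.nat 27 0 = b'

/-- The target and the two sources are read and written one column at a time, so copying in place is
safe. -/
theorem copySets_spec {s : Store} (hs : WeightsReady M c s) {v u b i h b' : ℕ}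
    (hreg : Registers s v u b i h b') (hv : v < M) (hu : u < M) (hb : b ≤ 1) (hb' : b' ≤ 1)
    (hh : h + 1 ≤ M - i) :
    (∀ l < M, tableSet M (copySets.eval s) u b (M - i) l =
      tableSet M s u b (M - i - (h + 1)) l + tableSet M s v b' (h + 1 - b') l) ∧
    (∀ w β γ, β ≤ 1 → γ ≤ M → ¬ (w = u ∧ β = b ∧ γ = M - i) → ∀ l < M,
      tableSet M (copySets.eval s) w β γ l = tableSet M s w β γ l) := by
  have key := eval_forLoop_induction (k := 28) (n := 1) (s := s)
    (c := copyCell)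
    (fun m s' => ∀ w β γ, β ≤ 1 → γ ≤ M → ∀ l < M, tableSet M s' w β γ l =
      if (w = u ∧ β = b ∧ γ = M - i) ∧ l < m then
        tableSet M s u b (M - i - (h + 1)) l + tableSet M s v b' (h + 1 - b') l
      else tableSet M s w β γ l)
    ?_ (by simp) ?_
  · rw [hs.card_groups] at key
    refine ⟨fun l hl => ?_, fun w β γ hβ hγ hne l hl => ?_⟩
    · have := key u b (M - i) hb (by omega) l hl
      rwa [if_pos ⟨⟨rfl, rfl, rfl⟩, hl⟩] at this
    · have := key w β γ hβ hγ l hl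
      rwa [if_neg (fun h => hne h.1)] at this
  · intro m s' x hP w β γ hβ hγ l hl
    rw [tableSet_setNat _ _ _ _ _ _ _ (by decide)]
    exact hP w β γ hβ hγ l hl
  · intro m hm s' hn hr hk hP w β γ hβ hγ l hl
    rw [hs.card_groups] at hm
    have hs' : WeightsReady M c s' := hs.frame hn hr (by decide) (by decide)
    have e21 : s'.nat 21 0 = v := by rw [hn 21 (by decide), hreg.child]
    have e22 : s'.nat 22 0 = u := by rw [hn 22 (by decide), hreg.parent]
    have e24 : s'.nat 24 0 = b := by rw [hn 24 (by decide), hreg.digit]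
    have e25 : s'.nat 25 0 = i := by rw [hn 25 (by decide), hreg.index]
    have e26 : s'.nat 26 0 = h := by rw [hn 26 (by decide), hreg.portion]
    have e27 : s'.nat 27 0 = b' := by rw [hn 27 (by decide), hreg.digit']
    have hpu : u + u + b ≤ 2 * (M + 1) := by omega
    have hpv : v + v + b' ≤ 2 * (M + 1) := by omega
    -- Column `m` has not been written before this iteration, so both sources still hold their
    -- original values there.
    have v1 := hP u b (M - i - (h + 1)) hb (by omega) m hm
    have v2 := hP v b' (h + 1 - b') hb' (by omega) m hm
    simp only [lt_irrefl, and_false, if_false] at v1 v2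
    unfold tableSet at v1 v2
    have heval : ∀ q, (copyCell.eval s').nat 7 q =
        if q = slabCell M (u + u + b) (M - i) m then
          tableSet M s u b (M - i - (h + 1)) m + tableSet M s v b' (h + 1 - b') m
        else s'.nat 7 q := by
      intro q
      simp only [copyCell, eval, nat_setNat, value_add, value_load, value_sub, value_lit, e21, e22, e24, e25,
        e26, e27, hk, hs'.card_groups, true_and]
      rw [hs'.slab_add hpu (by omega), hs'.slab_add hpu (by omega), hs'.slab_add hpv (by omega),
        v1, v2]
      rfl
    have hold := hP w β γ hβ hγ l hl
    refine (heval (slabCell M (w + w + β) γ l)).trans ?_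
    simp only [slabCell_inj hγ (Nat.sub_le M i) hl.le hm.le]
    by_cases hcell : (w = u ∧ β = b ∧ γ = M - i) ∧ l = m
    · obtain ⟨⟨rfl, rfl, rfl⟩, rfl⟩ := hcell
      simp
    -- Node and digit are recovered from `w + w + β` because both digits are at most 1.
    · rw [if_neg (fun hc => hcell ⟨⟨by omega, by omega, hc.2.1⟩, hc.2.2⟩)]
      refine hold.trans ?_
      by_cases hc : w = u ∧ β = b ∧ γ = M - i
      · have hne : l ≠ m := fun h => hcell ⟨hc, h⟩
        have : l < m + 1 ↔ l < m := by omega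
        simp [hc, this]
      · simp [hc]

theorem relax_spec {s : Store} (hs : WeightsReady M c s) {v u b i h b' : ℕ}
    (hreg : Registers s v u b i h b') (hv : v < M) (hu : u < M) (hb : b ≤ 1) (hb' : b' ≤ 1) :
    (∀ w β γ, β ≤ 1 → γ ≤ M → ¬ (w = u ∧ β = b ∧ γ = M - i) →
      SameAt M s (relax.eval s) w β γ) ∧
    ((h + 1 ≤ M - i ∧ tableValue M s u b (M - i) <
        tableValue M s u b (M - i - (h + 1)) + tableValue M s v b' (h + 1 - b') -
          b * b' * c u v) →
      tableValue M (relax.eval s) u b (M - i) =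
        tableValue M s u b (M - i - (h + 1)) + tableValue M s v b' (h + 1 - b') -
          b * b' * c u v ∧
      ∀ l < M, tableSet M (relax.eval s) u b (M - i) l =
        tableSet M s u b (M - i - (h + 1)) l + tableSet M s v b' (h + 1 - b') l) ∧
    (¬ (h + 1 ≤ M - i ∧ tableValue M s u b (M - i) <
        tableValue M s u b (M - i - (h + 1)) + tableValue M s v b' (h + 1 - b') -
          b * b' * c u v) → relax.eval s = s) := by
  have hpu : u + u + b ≤ 2 * (M + 1) := by omega
  have hpv : v + v + b' ≤ 2 * (M + 1) := by omega
  have hcand : candidate.value s = tableValue M s u b (M - i - (h + 1)) +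
      tableValue M s v b' (h + 1 - b') - b * b' * c u v := by
    simp only [realValue_sub, realValue_add, realValue_mul, realValue_load, value_add, value_load,
      value_sub, value_lit, hreg.child, hreg.parent, hreg.digit, hreg.index, hreg.portion,
      hreg.digit', hs.card_groups]
    rw [hs.row_add hpu, hs.row_add hpv, hs.row_add (by omega), hs.weight u hu v hv,
      hs.digit b hb, hs.digit b' hb']
    rfl
  have hcell : (rowExpr (nodeExpr 22 24) capacity).value s = rowCell M (u + u + b) (M - i) := by
    simp only [value_add, value_load, value_sub, value_lit, hreg.parent, hreg.digit, hreg.index,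
      hs.card_groups]
    rw [hs.row_add hpu]
  have htest : (Test.and (.natLe part capacity)
      (.not (.realLe candidate (.load 2 (rowExpr (nodeExpr 22 24) capacity))))).Holds s ↔
      (h + 1 ≤ M - i ∧ tableValue M s u b (M - i) <
        tableValue M s u b (M - i - (h + 1)) + tableValue M s v b' (h + 1 - b') -
          b * b' * c u v) := by
    rw [holds_and, holds_not, holds_realLe, hcand, realValue_load, hcell, not_le]
    simp only [holds_natLe, value_add, value_load, value_sub, value_lit, hreg.index, hreg.portion,
      hs.card_groups]
    rfl
  by_cases ht : h + 1 ≤ M - i ∧ tableValue M s u b (M - i) <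
        tableValue M s u b (M - i - (h + 1)) + tableValue M s v b' (h + 1 - b') -
          b * b' * c u v
  · have heval : relax.eval s =
        copySets.eval (s.setReal 2 (rowCell M (u + u + b) (M - i)) (candidate.value s)) := by
      unfold relax
      rw [eval, if_pos (htest.mpr ht), eval, eval, hcell]
    rw [hcand] at heval
    set s₁ := s.setReal 2 (rowCell M (u + u + b) (M - i)) _ with hs₁
    have hs₁' : WeightsReady M c s₁ := hs.frame (L := []) (L' := [2]) (fun _ _ => rfl)
      (fun a ha => real_setReal_of_ne _ _ _ (by simpa using ha)) (by decide) (by decide)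
    have hreg₁ : Registers s₁ v u b i h b' :=
      ⟨hreg.child, hreg.parent, hreg.digit, hreg.index, hreg.portion, hreg.digit'⟩
    obtain ⟨h1, h2⟩ := copySets_spec hs₁' hreg₁ hv hu hb hb' ht.1
    have hval : ∀ w β γ, tableValue M (copySets.eval s₁) w β γ = tableValue M s₁ w β γ := by
      intro w β γ
      unfold tableValue
      rw [eval_real copySets s₁ (by decide)]
    rw [heval]
    refine ⟨fun w β γ hβ hγ hne => ⟨?_, h2 w β γ hβ hγ hne⟩, fun _ => ⟨?_, h1⟩,
      fun hn => absurd ht hn⟩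
    · rw [hval]
      unfold tableValue
      rw [hs₁, real_setReal, if_neg]
      rintro ⟨-, h3⟩
      rw [rowCell_inj hγ (by omega)] at h3
      exact hne ⟨by omega, by omega, h3.2⟩
    · rw [hval]
      unfold tableValue
      rw [hs₁, real_setReal, if_pos ⟨rfl, rfl⟩]
      rfl
  · have heval : relax.eval s = s := by
      unfold relax
      rw [eval, if_neg (fun h => ht (htest.mp h)), eval]
    rw [heval]
    exact ⟨fun w β γ _ _ _ => SameAt.refl _ _ _ _, fun h => absurd h ht, fun _ => rfl⟩

/-- Two blocks that overlap in their roots only. -/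
structure Mergeable (M : ℕ) (c : ℕ → ℕ → ℝ) (D E : Finset ℕ) (u v : ℕ) : Prop where
  parent_lt : u < M
  child_lt : v < M
  parent_mem : u ∈ D
  child_mem : v ∈ E
  disjoint : Disjoint D E
  cross : ∀ a ∈ D, ∀ d ∈ E, c a d ≠ 0 → a = u ∧ d = v

theorem Mergeable.parent_not_mem {D E : Finset ℕ} {u v : ℕ} (h : Mergeable M c D E u v) :
    u ∉ E := fun h' => disjoint_left.mp h.disjoint h.parent_mem h'

theorem Mergeable.ne {D E : Finset ℕ} {u v : ℕ} (h : Mergeable M c D E u v) : v ≠ u :=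
  fun h' => h.parent_not_mem (h' ▸ h.child_mem)

/-- The root `u` is not in `E`, so every node taken from `E` uses up budget. -/
theorem Mergeable.card_inter_le {D E : Finset ℕ} {u v b g : ℕ} (h : Mergeable M c D E u v)
    {X T : Finset ℕ} (hT : Admissible X u b g T) : (T ∩ E).card ≤ g := by
  refine (card_le_card fun a ha => ?_).trans hT.2.2
  rw [mem_inter] at ha
  exact mem_erase.mpr ⟨fun h' => h.parent_not_mem (h' ▸ ha.2), ha.1⟩

/-- The sets that the first `j` passes through the inner loop of the dynamic program add. -/
def Considered (E : Finset ℕ) (v h j : ℕ) (T : Finset ℕ) : Prop :=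
  (T ∩ E).card ≤ h ∨ (T ∩ E).card = h + 1 ∧ (v ∈ T → 1 < j) ∧ (v ∉ T → 0 < j)

/-- The counter `h` stands for `h + 1` nodes taken from `E`. The step extends optimality from
competitors with at most `h` nodes in `E` to those with at most `h + 1`. It needs the old parent
entries for strictly smaller capacities only. -/
theorem relaxBoth_spec (hf : PairwiseCoverage M c f) {s : Store} (hs : WeightsReady M c s)
    {D E : Finset ℕ} {v u b i h : ℕ} (hm : Mergeable M c D E u v)
    (h21 : s.nat 21 0 = v) (h22 : s.nat 22 0 = u) (h24 : s.nat 24 0 = b) (h25 : s.nat 25 0 = i)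
    (h26 : s.nat 26 0 = h) (hb : b ≤ 1) (hh : h < M)
    (hD : ∀ γ < M - i, EntryAt M f (fun _ => True) D s u b γ)
    (hE : ∀ β ≤ 1, ∀ γ ≤ M, EntryAt M f (fun _ => True) E s v β γ)
    (hcur : EntryAt M f (fun T => (T ∩ E).card ≤ h) (D ∪ E) s u b (M - i)) :
    EntryAt M f (fun T => (T ∩ E).card ≤ h + 1) (D ∪ E) (relaxBoth.eval s) u b (M - i) ∧
    ∀ w β γ, β ≤ 1 → γ ≤ M → ¬ (w = u ∧ β = b ∧ γ = M - i) →
      SameAt M s (relaxBoth.eval s) w β γ := by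
  have key := eval_forLoop_induction (k := 27) (n := 4) (s := s) (c := relax)
    (fun j s' => EntryAt M f (Considered E v h j) (D ∪ E) s' u b (M - i) ∧
      ∀ w β γ, β ≤ 1 → γ ≤ M → ¬ (w = u ∧ β = b ∧ γ = M - i) → SameAt M s s' w β γ)
    ?_ ?_ ?_
  · rw [hs.two] at key
    -- After both digits have been tried, the conditions on `v` in `Considered` are void.
    refine ⟨Entry.mono key.1 fun T _ hT => ?_, key.2⟩
    rcases Nat.le_succ_iff.mp hT with h1 | h1
    · exact Or.inl h1
    · exact Or.inr ⟨h1, fun _ => one_lt_two, fun _ => two_pos⟩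
  · rintro j s' x ⟨h1, h2⟩
    exact ⟨h1.setNat _ _ (by decide),
      fun w β γ hβ hγ hne => (h2 w β γ hβ hγ hne).setNat _ _ (by decide)⟩
  · refine ⟨Entry.mono hcur fun T _ hT => ?_, fun w β γ _ _ _ => SameAt.refl _ _ _ _⟩
    rcases hT with h1 | ⟨-, h1, h2⟩
    · exact h1
    · by_cases hv : v ∈ T
      · exact absurd (h1 hv) (by omega)
      · exact absurd (h2 hv) (by omega)
  · rintro j hj s' hn hr hk ⟨hP, hsame⟩
    rw [hs.two] at hj
    have hs' : WeightsReady M c s' := hs.frame hn hr (by decide) (by decide)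
    have hreg : Registers s' v u b i h j :=
      ⟨by rw [hn 21 (by decide), h21], by rw [hn 22 (by decide), h22],
        by rw [hn 24 (by decide), h24], by rw [hn 25 (by decide), h25],
        by rw [hn 26 (by decide), h26], hk⟩
    obtain ⟨r1, r2, r3⟩ := relax_spec hs' hreg hm.child_lt hm.parent_lt hb (by omega)
    refine ⟨?_, fun w β γ hβ hγ hne => (hsame w β γ hβ hγ hne).trans (r1 w β γ hβ hγ hne)⟩
    by_cases hhi : h + 1 ≤ M - i
    · have e1 : EntryAt M f (fun _ => True) D s' u b (M - i - (h + 1)) :=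
        (hsame _ _ _ hb (by omega) (by omega)).entryAt (hD _ (by omega))
      have e2 : EntryAt M f (fun _ => True) E s' v j (h + 1 - j) :=
        (hsame _ _ _ (by omega) (by omega) (fun h' => hm.ne h'.1)).entryAt
          (hE _ (by omega) _ (by omega))
      have e3 := Entry.combine hf hb (by omega : j ≤ 1) (by omega) hhi hm.parent_mem hm.child_mem
        hm.disjoint hm.cross e1 e2
      -- Pass `j` adds exactly the competitors with `h + 1` nodes in `E` whose decision about `v` is
      -- `j`.
      have hclass : ∀ T, Considered E v h (j + 1) T →
          Considered E v h j T ∨ (v ∈ T ↔ j = 1) ∧ (T ∩ E).card = h + 1 := by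
        rintro T (hT | ⟨hT, h1, h2⟩)
        · exact Or.inl (Or.inl hT)
        · by_cases hv : v ∈ T
          · have := h1 hv
            exact Or.inr ⟨by simp only [hv, true_iff]; omega, hT⟩
          · by_cases hj0 : j = 0
            · exact Or.inr ⟨by simp [hv, hj0], hT⟩
            · exact Or.inl (Or.inr ⟨hT, fun h' => absurd h' hv, fun _ => by omega⟩)
      by_cases ht : tableValue M s' u b (M - i) <
          tableValue M s' u b (M - i - (h + 1)) + tableValue M s' v j (h + 1 - j) -
            b * j * c u v
      · obtain ⟨q1, q2⟩ := r2 ⟨hhi, ht⟩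
        exact ((Entry.or hP e3 ht.le).mono fun T _ hT => hclass T hT).congr q1 q2
      · rw [r3 (fun h' => ht h'.2)]
        exact (Entry.or e3 hP (not_lt.mp ht)).mono fun T _ hT => (hclass T hT).symm
    · rw [r3 (fun h' => hhi h'.1)]
      -- Here `h + 1` exceeds the capacity, so no admissible set takes that many nodes from `E` and
      -- nothing new has to be considered.
      refine Entry.mono hP fun T hT _ => Or.inl ?_
      have := hm.card_inter_le hT
      omega

/-- The bound on the number of nodes from `E` grows from 0 to `M`. At 0 the old parent entry is
correct by `Entry.union_right`; at `M` the bound no longer restricts anything. -/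
theorem relaxAll_spec (hf : PairwiseCoverage M c f) {s : Store} (hs : WeightsReady M c s)
    {D E : Finset ℕ} {v u b i : ℕ} (hm : Mergeable M c D E u v)
    (h21 : s.nat 21 0 = v) (h22 : s.nat 22 0 = u) (h24 : s.nat 24 0 = b) (h25 : s.nat 25 0 = i)
    (hb : b ≤ 1) (hD : ∀ γ ≤ M - i, EntryAt M f (fun _ => True) D s u b γ)
    (hE : ∀ β ≤ 1, ∀ γ ≤ M, EntryAt M f (fun _ => True) E s v β γ) :
    EntryAt M f (fun _ => True) (D ∪ E) (relaxAll.eval s) u b (M - i) ∧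
    ∀ w β γ, β ≤ 1 → γ ≤ M → ¬ (w = u ∧ β = b ∧ γ = M - i) →
      SameAt M s (relaxAll.eval s) w β γ := by
  have key := eval_forLoop_induction (k := 26) (n := 1) (s := s) (c := relaxBoth)
    (fun h s' => EntryAt M f (fun T => (T ∩ E).card ≤ h) (D ∪ E) s' u b (M - i) ∧
      ∀ w β γ, β ≤ 1 → γ ≤ M → ¬ (w = u ∧ β = b ∧ γ = M - i) → SameAt M s s' w β γ)
    ?_ ?_ ?_
  · rw [hs.card_groups] at key
    refine ⟨Entry.mono key.1 fun T hT _ => ?_, key.2⟩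
    have := hm.card_inter_le hT
    omega
  · rintro j s' x ⟨h1, h2⟩
    exact ⟨h1.setNat _ _ (by decide),
      fun w β γ hβ hγ hne => (h2 w β γ hβ hγ hne).setNat _ _ (by decide)⟩
  · exact ⟨(hD _ le_rfl).union_right, fun w β γ _ _ _ => SameAt.refl _ _ _ _⟩
  · rintro h hh s' hn hr hk ⟨hP, hsame⟩
    rw [hs.card_groups] at hh
    obtain ⟨q1, q2⟩ := relaxBoth_spec hf (hs.frame hn hr (by decide) (by decide)) hm
      (by rw [hn 21 (by decide), h21]) (by rw [hn 22 (by decide), h22])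
      (by rw [hn 24 (by decide), h24]) (by rw [hn 25 (by decide), h25]) hk hb hh
      (fun γ hγ => (hsame _ _ _ hb (by omega) (by omega)).entryAt (hD γ (by omega)))
      (fun β hβ γ hγ => (hsame _ _ _ hβ hγ (fun h' => hm.ne h'.1)).entryAt (hE β hβ γ hγ)) hP
    exact ⟨q1, fun w β γ hβ hγ hne => (hsame w β γ hβ hγ hne).trans (q2 w β γ hβ hγ hne)⟩

/-- Pass `i` treats the capacity `M - i`. As capacities decrease, those above `M - i` are already
new, while the smaller ones that the update reads still belong to the old block `D`. -/
theorem mergeRow_spec (hf : PairwiseCoverage M c f) {s : Store} (hs : WeightsReady M c s)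
    {D E : Finset ℕ} {v u b : ℕ} (hm : Mergeable M c D E u v)
    (h21 : s.nat 21 0 = v) (h22 : s.nat 22 0 = u) (h24 : s.nat 24 0 = b)
    (hb : b ≤ 1) (hD : ∀ γ ≤ M, EntryAt M f (fun _ => True) D s u b γ)
    (hE : ∀ β ≤ 1, ∀ γ ≤ M, EntryAt M f (fun _ => True) E s v β γ) :
    (∀ γ ≤ M, EntryAt M f (fun _ => True) (D ∪ E) (mergeRow.eval s) u b γ) ∧
    ∀ w β γ, β ≤ 1 → γ ≤ M → ¬ (w = u ∧ β = b) → SameAt M s (mergeRow.eval s) w β γ := by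
  have key := eval_forLoop_induction (k := 25) (n := 3) (s := s) (c := relaxAll)
    (fun i s' => (∀ γ ≤ M, M < γ + i → EntryAt M f (fun _ => True) (D ∪ E) s' u b γ) ∧
      ∀ w β γ, β ≤ 1 → γ ≤ M → ¬ (w = u ∧ β = b ∧ M < γ + i) → SameAt M s s' w β γ)
    ?_ ?_ ?_
  · rw [hs.row_length] at key
    exact ⟨fun γ hγ => key.1 γ hγ (by omega),
      fun w β γ hβ hγ hne => key.2 w β γ hβ hγ fun h' => hne ⟨h'.1, h'.2.1⟩⟩
  · rintro j s' x ⟨h1, h2⟩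
    exact ⟨fun γ hγ hi => (h1 γ hγ hi).setNat _ _ (by decide),
      fun w β γ hβ hγ hne => (h2 w β γ hβ hγ hne).setNat _ _ (by decide)⟩
  · exact ⟨fun γ hγ hi => absurd hi (by omega), fun w β γ _ _ _ => SameAt.refl _ _ _ _⟩
  · rintro i hi s' hn hr hk ⟨hP, hsame⟩
    rw [hs.row_length] at hi
    obtain ⟨q1, q2⟩ := relaxAll_spec hf (hs.frame hn hr (by decide) (by decide)) hm
      (by rw [hn 21 (by decide), h21]) (by rw [hn 22 (by decide), h22])
      (by rw [hn 24 (by decide), h24]) hk hb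
      (fun γ hγ => (hsame _ _ _ hb (by omega) (by omega)).entryAt (hD γ (by omega)))
      (fun β hβ γ hγ => (hsame _ _ _ hβ hγ (fun h' => hm.ne h'.1)).entryAt (hE β hβ γ hγ))
    refine ⟨fun γ hγ hγi => ?_, fun w β γ hβ hγ hne => ?_⟩
    · by_cases h1 : γ = M - i
      · rw [h1]; exact q1
      · exact (q2 u b γ hb hγ (fun h' => h1 h'.2.2)).entryAt (hP γ hγ (by omega))
    · exact (hsame w β γ hβ hγ (by omega)).trans (q2 w β γ hβ hγ (by omega))

/-- The two digits of the parent do not interfere: an update for one digit reads only the parent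
entries with that digit and the entries of the child, which stay unchanged since `v ≠ u`. -/
theorem merge_spec (hf : PairwiseCoverage M c f) {s : Store} (hs : WeightsReady M c s)
    {D E : Finset ℕ} {v u : ℕ} (hm : Mergeable M c D E u v)
    (h21 : s.nat 21 0 = v) (h22 : s.nat 22 0 = u)
    (hD : ∀ β ≤ 1, ∀ γ ≤ M, EntryAt M f (fun _ => True) D s u β γ)
    (hE : ∀ β ≤ 1, ∀ γ ≤ M, EntryAt M f (fun _ => True) E s v β γ) :
    (∀ β ≤ 1, ∀ γ ≤ M, EntryAt M f (fun _ => True) (D ∪ E) (merge.eval s) u β γ) ∧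
    ∀ w β γ, β ≤ 1 → γ ≤ M → w ≠ u → SameAt M s (merge.eval s) w β γ := by
  have key := eval_forLoop_induction (k := 24) (n := 4) (s := s) (c := mergeRow)
    (fun j s' => (∀ β ≤ 1, β < j → ∀ γ ≤ M,
        EntryAt M f (fun _ => True) (D ∪ E) s' u β γ) ∧
      ∀ w β γ, β ≤ 1 → γ ≤ M → ¬ (w = u ∧ β < j) → SameAt M s s' w β γ)
    ?_ ?_ ?_
  · rw [hs.two] at key
    exact ⟨fun β hβ => key.1 β hβ (by omega),
      fun w β γ hβ hγ hne => key.2 w β γ hβ hγ fun h' => hne h'.1⟩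
  · rintro j s' x ⟨h1, h2⟩
    exact ⟨fun β hβ hj γ hγ => (h1 β hβ hj γ hγ).setNat _ _ (by decide),
      fun w β γ hβ hγ hne => (h2 w β γ hβ hγ hne).setNat _ _ (by decide)⟩
  · exact ⟨fun β hβ hi => absurd hi (by omega), fun w β γ _ _ _ => SameAt.refl _ _ _ _⟩
  · rintro j hj s' hn hr hk ⟨hP, hsame⟩
    rw [hs.two] at hj
    obtain ⟨q1, q2⟩ := mergeRow_spec hf (hs.frame hn hr (by decide) (by decide)) hm
      (by rw [hn 21 (by decide), h21]) (by rw [hn 22 (by decide), h22]) hk (by omega)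
      (fun γ hγ => (hsame _ _ _ (by omega) (by omega) (by omega)).entryAt
        (hD j (by omega) γ (by omega)))
      (fun β hβ γ hγ => (hsame _ _ _ hβ hγ (fun h' => hm.ne h'.1)).entryAt (hE β hβ γ hγ))
    refine ⟨fun β hβ hβj γ hγ => ?_, fun w β γ hβ hγ hne => ?_⟩
    · by_cases h1 : β = j
      · rw [h1]; exact q1 γ hγ
      · exact (q2 u β γ hβ hγ (fun h' => h1 h'.2)).entryAt (hP β hβ (by omega) γ hγ)
    · exact (hsame w β γ hβ hγ (by omega)).trans (q2 w β γ hβ hγ (by omega))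

/-! ### Elimination of leaves -/

/-- The nodes that have not been merged into other nodes. -/
def alive (M : ℕ) (s : Store) : Finset ℕ := (range M).filter fun v => s.nat 8 v = 0

theorem mem_alive {s : Store} {v : ℕ} : v ∈ alive M s ↔ v < M ∧ s.nat 8 v = 0 := by
  simp [alive]

theorem alive_congr {s s' : Store} (h : s'.nat 8 = s.nat 8) : alive M s' = alive M s := by
  unfold alive
  rw [h]

/-- The table is as it should be. -/
def TableReady (M : ℕ) (c : ℕ → ℕ → ℝ) (f : Finset ℕ → ℝ) (s : Store) : Prop :=
  ∃ B, Blocks M c (alive M s) B ∧ ∀ v ∈ alive M s, ∀ β ≤ 1, ∀ γ ≤ M,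
    EntryAt M f (fun _ => True) (B v) s v β γ

theorem TableReady.congr {s s' : Store} (h : TableReady M c f s) (h2 : s'.real 2 = s.real 2)
    (h7 : s'.nat 7 = s.nat 7) (h8 : s'.nat 8 = s.nat 8) : TableReady M c f s' := by
  obtain ⟨B, hB, hent⟩ := h
  refine ⟨B, by rwa [alive_congr h8], fun v hv β hβ γ hγ => ?_⟩
  rw [alive_congr h8] at hv
  refine SameAt.entryAt ⟨?_, fun l _ => ?_⟩ (hent v hv β hβ γ hγ)
  · unfold tableValue; rw [h2]
  · unfold tableSet; rw [h7]

/-- Writes `1` into register `9` if some other node than those in the registers `21` and `22`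
overlaps with the one in register `21`. -/
def leafCell : ForProgram :=
  .ite (.and (.and (natEq (.load 8 (reg 23)) (.lit 0))
      (.and (.not (natEq (reg 23) (reg 21))) (.not (natEq (reg 23) (reg 22)))))
    (.not (.realLe (.load 1 (rowExpr (reg 21) (reg 23))) (.lit 0))))
    (.setNat 9 (.lit 0) (.lit 1)) .skip

/-- Looks for such a node. -/
def leafTest : ForProgram := .seq (.setNat 9 (.lit 0) (.lit 0)) (.forLoop 23 1 leafCell)

theorem leafTest_spec (hf : PairwiseCoverage M c f) {s : Store} (hs : WeightsReady M c s)
    {v u : ℕ} (h21 : s.nat 21 0 = v) (h22 : s.nat 22 0 = u) (hv : v < M) :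
    (leafTest.eval s).nat 9 0 = 0 ↔ ∀ w ∈ alive M s, w ≠ v → w ≠ u → c v w = 0 := by
  set s₁ := s.setNat 9 0 0 with hs₁
  have hn₁ : ∀ a, a ∉ [9] → s₁.nat a = s.nat a :=
    fun a ha => nat_setNat_of_ne _ _ _ (by simpa using ha)
  have hw₁ : WeightsReady M c s₁ :=
    hs.frame (L' := []) hn₁ (fun _ _ => rfl) (by decide) (by decide)
  have key := eval_forLoop_induction (k := 23) (n := 1) (s := s₁) (c := leafCell)
    (fun m s' => s'.nat 9 0 = 0 ↔ ∀ w < m, w ∈ alive M s → w ≠ v → w ≠ u → c v w = 0)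
    ?_ ?_ ?_
  · rw [hw₁.card_groups] at key
    refine key.trans ⟨fun h w hw => h w (mem_alive.mp hw).1 hw, fun h w _ hw => h w hw⟩
  · intro m s' x h
    rwa [nat_setNat_of_ne _ _ _ (by decide)]
  · simp [hs₁, nat_setNat]
  · intro m hm s' hn hr hk hP
    rw [hw₁.card_groups] at hm
    have hs' : WeightsReady M c s' := hw₁.frame hn hr (by decide) (by decide)
    have e21 : s'.nat 21 0 = v := by rw [hn 21 (by decide), hn₁ 21 (by decide), h21]
    have e22 : s'.nat 22 0 = u := by rw [hn 22 (by decide), hn₁ 22 (by decide), h22]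
    have e8 : s'.nat 8 = s.nat 8 := by rw [hn 8 (by decide), hn₁ 8 (by decide)]
    -- Overlaps are nonnegative, so a single comparison detects the nonzero ones.
    have hc : ¬ c v m ≤ 0 ↔ c v m ≠ 0 := by
      rw [not_iff_not]
      exact ⟨fun h => le_antisymm h (hf.nonneg _ _), fun h => h.le⟩
    have hstep : (leafCell.eval s').nat 9 0 =
        if m ∈ alive M s ∧ m ≠ v ∧ m ≠ u ∧ c v m ≠ 0 then 1 else s'.nat 9 0 := by
      simp only [leafCell, eval, holds_and, holds_not, holds_natLe, holds_realLe, value_load,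
        value_lit, value_add, realValue_load, realValue_lit, hk, e21, e22, e8, Nat.cast_zero]
      rw [hs'.row_add (by omega), hs'.weight v hv m hm]
      by_cases ht : m ∈ alive M s ∧ m ≠ v ∧ m ≠ u ∧ c v m ≠ 0
      · have := mem_alive.mp ht.1
        rw [if_pos ht, if_pos ⟨⟨⟨by omega, by omega⟩, by omega, by omega⟩, hc.mpr ht.2.2.2⟩]
        simp [nat_setNat]
      · rw [if_neg ht, if_neg]
        rintro ⟨⟨⟨h1, -⟩, h2, h3⟩, h4⟩
        exact ht ⟨mem_alive.mpr ⟨hm, by omega⟩, by omega, by omega, hc.mp h4⟩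
    rw [hstep]
    split_ifs with ht
    · simp only [false_iff]
      intro h
      exact ht.2.2.2 (h m (by omega) ht.1 ht.2.1 ht.2.2.1)
    · rw [hP]
      refine ⟨fun h w hw => ?_, fun h w hw => h w (by omega)⟩
      rcases Nat.lt_succ_iff_lt_or_eq.mp hw with h' | rfl
      · exact h w h'
      · intro h1 h2 h3
        by_contra h4
        exact ht ⟨h1, h2, h3, h4⟩

/-- Merges the node in register `21` into the one in register `22` if it is a leaf. -/
def eliminateLeaf : ForProgram :=
  .seq leafTest
    (.ite (.and (.and (natEq (reg 9) (.lit 0)) (.not (natEq (reg 21) (reg 22))))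
      (.and (natEq (.load 8 (reg 21)) (.lit 0)) (natEq (.load 8 (reg 22)) (.lit 0))))
      (.seq merge (.setNat 8 (reg 21) (.lit 1))) .skip)

theorem eliminateLeaf_spec (hf : PairwiseCoverage M c f) {s : Store} (hs : WeightsReady M c s)
    {v u : ℕ} (h21 : s.nat 21 0 = v) (h22 : s.nat 22 0 = u) (hv : v < M) (hu : u < M)
    (ht : TableReady M c f s) :
    TableReady M c f (eliminateLeaf.eval s) ∧
    (IsLeaf c (alive M s) v u → alive M (eliminateLeaf.eval s) = (alive M s).erase v) ∧
    (¬ IsLeaf c (alive M s) v u → alive M (eliminateLeaf.eval s) = alive M s) := by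
  set s₁ := leafTest.eval s with hs₁
  have hn₁ : ∀ a, a ∉ leafTest.natWrites → s₁.nat a = s.nat a :=
    fun a ha => eval_nat leafTest s ha
  have hr₁ : ∀ a, a ∉ leafTest.realWrites → s₁.real a = s.real a :=
    fun a ha => eval_real leafTest s ha
  have hw₁ : WeightsReady M c s₁ := hs.frame hn₁ hr₁ (by decide) (by decide)
  have e21 : s₁.nat 21 0 = v := by rw [hn₁ 21 (by decide), h21]
  have e22 : s₁.nat 22 0 = u := by rw [hn₁ 22 (by decide), h22]
  have e8 : s₁.nat 8 = s.nat 8 := hn₁ 8 (by decide)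
  have ht₁ : TableReady M c f s₁ := ht.congr (hr₁ 2 (by decide)) (hn₁ 7 (by decide)) e8
  have halive : alive M s₁ = alive M s := alive_congr e8
  have htest : (Test.and (.and (natEq (reg 9) (.lit 0)) (.not (natEq (reg 21) (reg 22))))
      (.and (natEq (.load 8 (reg 21)) (.lit 0)) (natEq (.load 8 (reg 22)) (.lit 0)))).Holds s₁ ↔
      IsLeaf c (alive M s) v u := by
    have h9 := leafTest_spec hf hs h21 h22 hv
    unfold IsLeaf
    rw [← h9, mem_alive, mem_alive, ← hs₁]
    simp only [holds_and, holds_not, holds_natLe, value_load, value_lit, e21, e22, e8]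
    omega
  by_cases hl : IsLeaf c (alive M s) v u
  · have heval : eliminateLeaf.eval s = (merge.eval s₁).setNat 8 v 1 := by
      unfold eliminateLeaf
      rw [eval, ← hs₁, eval, if_pos (htest.mpr hl), eval, eval]
      simp only [value_load, value_lit]
      rw [eval_nat merge s₁ (by decide), e21]
    have halive' : alive M (eliminateLeaf.eval s) = (alive M s).erase v := by
      ext w
      rw [heval, mem_erase, mem_alive, mem_alive, nat_setNat, eval_nat merge s₁ (by decide), e8]
      by_cases hwv : w = v <;> simp [hwv]
    refine ⟨?_, fun _ => halive', fun h => absurd hl h⟩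
    obtain ⟨B, hB, hent⟩ := ht₁
    rw [halive] at hB hent
    have ⟨hvR, huR, hvu, _⟩ := hl
    have hm : Mergeable M c (B u) (B v) u v :=
      ⟨hu, hv, hB.root_mem u huR, hB.root_mem v hvR, hB.disjoint u huR v hvR hvu.symm,
        hB.cross u huR v hvR hvu.symm⟩
    obtain ⟨m1, m2⟩ := merge_spec hf hw₁ hm e21 e22 (hent u huR) (hent v hvR)
    refine ⟨Function.update B u (B u ∪ B v), ?_, fun w hw β hβ γ hγ => ?_⟩
    · rw [halive']
      exact hB.merge hf.symm hl
    · rw [halive', mem_erase] at hw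
      rw [heval]
      refine EntryAt.setNat ?_ _ _ (by decide)
      by_cases hwu : w = u
      · subst hwu
        rw [Function.update_self]
        exact m1 β hβ γ hγ
      · rw [Function.update_of_ne hwu]
        exact (m2 w β γ hβ hγ hwu).entryAt (hent w hw.2 β hβ γ hγ)
  · have heval : eliminateLeaf.eval s = s₁ := by
      unfold eliminateLeaf
      rw [eval, ← hs₁, eval, if_neg (fun h => hl (htest.mp h)), eval]
    rw [heval]
    exact ⟨ht₁, fun h => absurd h hl, fun _ => halive⟩

/-- Tries to merge one node into each other node. -/
def eliminateInto : ForProgram := .forLoop 22 1 eliminateLeaf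

/-- Tries to merge each node into each other node. -/
def eliminatePass : ForProgram := .forLoop 21 1 eliminateInto

/-- Merges nodes until at most one is left. -/
def eliminateAll : ForProgram := .forLoop 20 1 eliminatePass

/-- Either some node has been merged, or none has, and there is no leaf among the pairs in `P`. -/
def Progress (M : ℕ) (c : ℕ → ℕ → ℝ) (P : ℕ → ℕ → Prop) (R : Finset ℕ) (s : Store) : Prop :=
  (alive M s = R ∧ ∀ v u, P v u → ¬ IsLeaf c R v u) ∨
    ((alive M s).card < R.card ∧ (alive M s).Nonempty)

theorem Progress.mono {P Q : ℕ → ℕ → Prop} {R : Finset ℕ} {s : Store}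
    (h : Progress M c P R s) (hPQ : ∀ v u, IsLeaf c R v u → Q v u → P v u) :
    Progress M c Q R s := by
  rcases h with ⟨h1, h2⟩ | h
  · exact Or.inl ⟨h1, fun v u hQ hl => h2 v u (hPQ v u hl hQ) hl⟩
  · exact Or.inr h

theorem Progress.congr {P : ℕ → ℕ → Prop} {R : Finset ℕ} {s s' : Store}
    (h : Progress M c P R s) (h8 : s'.nat 8 = s.nat 8) : Progress M c P R s' := by
  unfold Progress
  rwa [alive_congr h8]

/-- As long as nothing has been merged, the surviving set is still `R`, so a failed test rules out a
leaf of `R`. Once a merge has happened, the second alternative persists, because each further merge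
leaves its parent `u` alive. -/
theorem eliminateLeaf_progress (hf : PairwiseCoverage M c f) {s : Store}
    (hs : WeightsReady M c s) {v u : ℕ} (h21 : s.nat 21 0 = v) (h22 : s.nat 22 0 = u) (hv : v < M)
    (hu : u < M) (ht : TableReady M c f s) {P : ℕ → ℕ → Prop} {R : Finset ℕ}
    (hP : Progress M c P R s) :
    Progress M c (fun a b => P a b ∨ a = v ∧ b = u) R (eliminateLeaf.eval s) := by
  obtain ⟨-, h1, h2⟩ := eliminateLeaf_spec hf hs h21 h22 hv hu ht
  by_cases hl : IsLeaf c (alive M s) v u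
  · right
    rw [h1 hl]
    refine ⟨?_, u, mem_erase.mpr ⟨hl.2.2.1.symm, hl.2.1⟩⟩
    have := card_erase_lt_of_mem hl.1
    rcases hP with ⟨h3, -⟩ | ⟨h3, -⟩
    · rwa [h3] at this ⊢
    · exact this.trans h3
  · unfold Progress
    rw [h2 hl]
    rcases hP with ⟨h3, h4⟩ | h3
    · left
      refine ⟨h3, fun a b hab => ?_⟩
      rcases hab with hab | ⟨rfl, rfl⟩
      · exact h4 a b hab
      · rwa [h3] at hl
    · exact Or.inr h3

theorem eliminateInto_spec (hf : PairwiseCoverage M c f) {s : Store}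
    (hs : WeightsReady M c s) {v : ℕ} (h21 : s.nat 21 0 = v) (hv : v < M)
    (ht : TableReady M c f s) {R : Finset ℕ}
    (hP : Progress M c (fun a _ => a < v) R s) :
    TableReady M c f (eliminateInto.eval s) ∧
      Progress M c (fun a b => a < v ∨ a = v ∧ b < M) R (eliminateInto.eval s) := by
  have key := eval_forLoop_induction (k := 22) (n := 1) (s := s) (c := eliminateLeaf)
    (fun m s' => TableReady M c f s' ∧ Progress M c (fun a b => a < v ∨ a = v ∧ b < m) R s')
    ?_ ?_ ?_
  · rw [hs.card_groups] at key
    exact key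
  · rintro m s' x ⟨h1, h2⟩
    exact ⟨h1.congr rfl (nat_setNat_of_ne _ _ _ (by decide)) (nat_setNat_of_ne _ _ _ (by decide)),
      h2.congr (nat_setNat_of_ne _ _ _ (by decide))⟩
  · exact ⟨ht, hP.mono fun a b _ h => by omega⟩
  · rintro m hm s' hn hr hk ⟨h1, h2⟩
    rw [hs.card_groups] at hm
    have hs' : WeightsReady M c s' := hs.frame hn hr (by decide) (by decide)
    have e21 : s'.nat 21 0 = v := by rw [hn 21 (by decide), h21]
    exact ⟨(eliminateLeaf_spec hf hs' e21 hk hv hm h1).1,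
      (eliminateLeaf_progress hf hs' e21 hk hv hm h1 h2).mono fun a b _ h => by omega⟩

theorem eliminatePass_spec (hf : PairwiseCoverage M c f) {s : Store}
    (hs : WeightsReady M c s) (ht : TableReady M c f s) :
    TableReady M c f (eliminatePass.eval s) ∧
      Progress M c (fun a _ => a < M) (alive M s) (eliminatePass.eval s) := by
  have key := eval_forLoop_induction (k := 21) (n := 1) (s := s) (c := eliminateInto)
    (fun m s' => TableReady M c f s' ∧ Progress M c (fun a _ => a < m) (alive M s) s')
    ?_ ?_ ?_
  · rw [hs.card_groups] at key
    exact key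
  · rintro m s' x ⟨h1, h2⟩
    exact ⟨h1.congr rfl (nat_setNat_of_ne _ _ _ (by decide)) (nat_setNat_of_ne _ _ _ (by decide)),
      h2.congr (nat_setNat_of_ne _ _ _ (by decide))⟩
  · exact ⟨ht, Or.inl ⟨rfl, fun a b h => absurd h (by omega)⟩⟩
  · rintro m hm s' hn hr hk ⟨h1, h2⟩
    rw [hs.card_groups] at hm
    have hs' : WeightsReady M c s' := hs.frame hn hr (by decide) (by decide)
    obtain ⟨h3, h4⟩ := eliminateInto_spec hf hs' hk hm h1 h2
    -- The bound on the second node can be dropped, since a possible parent is alive and hence below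
    -- `M`.
    refine ⟨h3, h4.mono fun a b hl h => ?_⟩
    have := (mem_alive.mp hl.2.1).1
    omega

/-- A pass without a merge has found no leaf, so by the forest property at most one node is left.
Every other pass removes a node, hence `M` passes suffice. -/
theorem eliminateAll_spec (hf : PairwiseCoverage M c f) {s : Store}
    (hs : WeightsReady M c s) (ht : TableReady M c f s) (hne : (alive M s).Nonempty) :
    TableReady M c f (eliminateAll.eval s) ∧ ∃ r, alive M (eliminateAll.eval s) = {r} := by
  have key := eval_forLoop_induction (k := 20) (n := 1) (s := s) (c := eliminatePass)
    (fun m s' => TableReady M c f s' ∧ (alive M s').Nonempty ∧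
      ((alive M s').card ≤ 1 ∨ (alive M s').card + m ≤ M))
    ?_ ?_ ?_
  · rw [hs.card_groups] at key
    obtain ⟨h1, h2, h3⟩ := key
    refine ⟨h1, card_eq_one.mp (le_antisymm ?_ (card_pos.mpr h2))⟩
    change (alive M (eliminateAll.eval s)).card ≤ 1 ∨
      (alive M (eliminateAll.eval s)).card + M ≤ M at h3
    omega
  · rintro m s' x ⟨h1, h2⟩
    refine ⟨h1.congr rfl (nat_setNat_of_ne _ _ _ (by decide))
      (nat_setNat_of_ne _ _ _ (by decide)), ?_⟩
    rwa [alive_congr (nat_setNat_of_ne _ _ _ (by decide))]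
  · refine ⟨ht, hne, Or.inr ?_⟩
    simpa [alive] using card_le_card (filter_subset (fun v => s.nat 8 v = 0) (range M))
  · rintro m hm s' hn hr hk ⟨h1, h2, h3⟩
    have hs' : WeightsReady M c s' := hs.frame hn hr (by decide) (by decide)
    obtain ⟨h4, h5⟩ := eliminatePass_spec hf hs' h1
    refine ⟨h4, ?_⟩
    rcases h5 with ⟨h5, h6⟩ | ⟨h5, h6⟩
    · rw [h5]
      refine ⟨h2, Or.inl ?_⟩
      by_contra hcard
      obtain ⟨v, hv, u, hu, hvu, hleaf⟩ :=
        hf.forest (alive M s') (filter_subset _ _) (by omega)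
      exact h6 v u (mem_alive.mp hv).1 ⟨hv, hu, hvu, hleaf⟩
    · exact ⟨h6, by omega⟩

end WMC

namespace WMC

open RealRAM RealRAM.ForProgram Finset

/-! ### Initialization of the table -/

section Init

variable {M : ℕ} {c : ℕ → ℕ → ℝ} {f : Finset ℕ → ℝ}

/-- The address of the entries in which the node in register `20` is taken. -/
abbrev takenExpr : NatExpr := .add (.add (reg 20) (reg 20)) (.lit 1)

/-- Initializes one entry. -/
def initCell : ForProgram :=
  .seq (.setReal 2 (rowExpr takenExpr (reg 21)) (.load 1 (rowExpr (reg 20) (reg 20))))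
    (.setNat 7 (slabExpr takenExpr (reg 21) (reg 20)) (.lit 1))

/-- Initializes the entries of one node. -/
def initRow : ForProgram := .forLoop 21 3 initCell

/-- Initializes the table. -/
def initTable : ForProgram := .forLoop 20 1 initRow

theorem initCell_spec {s : Store} (hs : WeightsReady M c s) {v g : ℕ} (hv : v < M) (hg : g ≤ M)
    (h20 : s.nat 20 0 = v) (h21 : s.nat 21 0 = g) : ∀ w β γ, β ≤ 1 → γ ≤ M →
      (tableValue M (initCell.eval s) w β γ =
        if w = v ∧ β = 1 ∧ γ = g then c w w else tableValue M s w β γ) ∧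
      ∀ l < M, tableSet M (initCell.eval s) w β γ l =
        if (w = v ∧ β = 1 ∧ γ = g) ∧ l = w then 1 else tableSet M s w β γ l := by
  intro w β γ hβ hγ
  have hp : v + v + 1 ≤ 2 * (M + 1) := by omega
  have heval : initCell.eval s = (s.setReal 2 (rowCell M (v + v + 1) g) (c v v)).setNat 7
      (slabCell M (v + v + 1) g v) 1 := by
    simp only [initCell, eval, value_add, value_load, value_lit, realValue_load, nat_setReal, h20,
      h21]
    rw [hs.row_add hp, hs.row_add (by omega), hs.slab_add hp hg, hs.weight v hv v hv]
  have hiff : w + w + β = v + v + 1 ∧ γ = g ↔ w = v ∧ β = 1 ∧ γ = g := by omega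
  rw [heval]
  constructor
  · unfold tableValue
    simp only [real_setNat, real_setReal, rowCell_inj hγ hg, hiff, true_and]
    split_ifs with h
    · rw [h.1]
    · rfl
  · intro l hl
    unfold tableSet
    simp only [nat_setNat, nat_setReal, slabCell_inj hγ hg hl.le hv.le, true_and]
    refine if_congr ?_ rfl rfl
    omega

theorem initRow_spec {s : Store} (hs : WeightsReady M c s) {v : ℕ} (hv : v < M)
    (h20 : s.nat 20 0 = v) : ∀ w β γ, β ≤ 1 → γ ≤ M →
      (tableValue M (initRow.eval s) w β γ =
        if w = v ∧ β = 1 then c w w else tableValue M s w β γ) ∧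
      ∀ l < M, tableSet M (initRow.eval s) w β γ l =
        if (w = v ∧ β = 1) ∧ l = w then 1 else tableSet M s w β γ l := by
  have key := eval_forLoop_induction (k := 21) (n := 3) (s := s) (c := initCell)
    (fun m s' => ∀ w β γ, β ≤ 1 → γ ≤ M →
      (tableValue M s' w β γ =
        if w = v ∧ β = 1 ∧ γ < m then c w w else tableValue M s w β γ) ∧
      ∀ l < M, tableSet M s' w β γ l =
        if (w = v ∧ β = 1 ∧ γ < m) ∧ l = w then 1 else tableSet M s w β γ l)
    ?_ (by simp) ?_
  · rw [hs.row_length] at key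
    intro w β γ hβ hγ
    have := key w β γ hβ hγ
    simp only [Nat.lt_succ_of_le hγ, and_true] at this
    exact this
  · intro m s' x h w β γ hβ hγ
    exact ⟨(h w β γ hβ hγ).1, fun l hl =>
      (tableSet_setNat _ _ _ _ _ _ _ (by decide)).trans ((h w β γ hβ hγ).2 l hl)⟩
  · intro m hm s' hn hr hk h w β γ hβ hγ
    rw [hs.row_length] at hm
    have hs' : WeightsReady M c s' := hs.frame hn hr (by decide) (by decide)
    obtain ⟨h1, h2⟩ := initCell_spec hs' hv (Nat.le_of_lt_succ hm)
      (by rw [hn 20 (by decide), h20]) hk w β γ hβ hγ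
    obtain ⟨h3, h4⟩ := h w β γ hβ hγ
    refine ⟨?_, fun l hl => ?_⟩
    · rw [h1, h3]
      split_ifs <;> first | rfl | omega
    · rw [h2 l hl, h4 l hl]
      split_ifs <;> first | rfl | omega

/-- For singleton blocks only the entries with digit 1 have to be written. Those with digit 0 stand
for the empty set with value 0, which is what the zeroed memory already contains. -/
theorem initTable_spec (hf : PairwiseCoverage M c f) {s : Store} (hs : WeightsReady M c s)
    (h2 : ∀ q, s.real 2 q = 0) (h7 : ∀ q, s.nat 7 q = 0) (h8 : ∀ q, s.nat 8 q = 0) :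
    TableReady M c f (initTable.eval s) ∧ alive M (initTable.eval s) = range M := by
  have key := eval_forLoop_induction (k := 20) (n := 1) (s := s) (c := initRow)
    (fun m s' => ∀ w β γ, β ≤ 1 → γ ≤ M →
      (tableValue M s' w β γ = if w < m ∧ β = 1 then c w w else 0) ∧
      ∀ l < M, tableSet M s' w β γ l = if (w < m ∧ β = 1) ∧ l = w then 1 else 0)
    ?_ ?_ ?_
  · rw [hs.card_groups] at key
    have halive : alive M (initTable.eval s) = range M := by
      rw [alive_congr (eval_nat initTable s (by decide))]
      simp [alive, h8]
    refine ⟨⟨fun v => {v}, by rw [halive]; exact blocks_singleton, fun v hv β hβ γ hγ => ?_⟩,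
      halive⟩
    rw [halive, mem_range] at hv
    obtain ⟨k1, k2⟩ := key v β γ hβ hγ
    change tableValue M (initTable.eval s) v β γ = _ at k1
    change ∀ l < M, tableSet M (initTable.eval s) v β γ l = _ at k2
    by_cases hβ1 : β = 1
    · refine ⟨{v}, ⟨Subset.refl _, by simp [hβ1], by simp⟩, ?_, fun l hl => ?_, fun T hT _ => ?_⟩
      · rw [k1, if_pos ⟨hv, hβ1⟩, hf.singleton]
      · rw [k2 l hl]
        simp [hv, hβ1]
      · rw [k1, if_pos ⟨hv, hβ1⟩, ← hf.singleton,
          Subset.antisymm hT.1 (singleton_subset_iff.mpr (hT.2.1.mpr hβ1))]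
    · refine ⟨∅, ⟨empty_subset _, by simp [hβ1], by simp⟩, ?_, fun l hl => ?_, fun T hT _ => ?_⟩
      · rw [k1, if_neg (fun h => hβ1 h.2), hf.empty]
      · rw [k2 l hl]
        simp [hβ1]
      · have hvT : v ∉ T := fun h => hβ1 (hT.2.1.mp h)
        have : T = ∅ := (subset_singleton_iff.mp hT.1).resolve_right
          (fun h => hvT (h ▸ mem_singleton_self v))
        rw [k1, if_neg (fun h => hβ1 h.2), this, hf.empty]
  · intro m s' x h w β γ hβ hγ
    exact ⟨(h w β γ hβ hγ).1, fun l hl =>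
      (tableSet_setNat _ _ _ _ _ _ _ (by decide)).trans ((h w β γ hβ hγ).2 l hl)⟩
  · intro w β γ _ _
    simp [tableValue, tableSet, h2, h7]
  · intro m hm s' hn hr hk h w β γ hβ hγ
    rw [hs.card_groups] at hm
    have hs' : WeightsReady M c s' := hs.frame hn hr (by decide) (by decide)
    obtain ⟨h1, h2⟩ := initRow_spec hs' hm hk w β γ hβ hγ
    obtain ⟨h3, h4⟩ := h w β γ hβ hγ
    refine ⟨?_, fun l hl => ?_⟩
    · rw [h1, h3]
      split_ifs <;> first | rfl | omega
    · rw [h2 l hl, h4 l hl]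
      split_ifs <;> first | rfl | omega

/-! ### Reading off an optimal selection -/

/-- `S` is a set of at most `G` nodes which covers as much as possible. -/
def OptimalSelection (M : ℕ) (f : Finset ℕ → ℝ) (G : ℕ) (S : Finset ℕ) : Prop :=
  S ⊆ range M ∧ S.card ≤ G ∧ ∀ T ⊆ range M, T.card ≤ G → f T ≤ f S

/-- Writes the remaining node into register `10`. -/
def findRoot : ForProgram :=
  .forLoop 20 1 (.ite (natEq (.load 8 (reg 20)) (.lit 0)) (.setNat 10 (.lit 0) (reg 20)) .skip)

theorem findRoot_spec {s : Store} (hs : WeightsReady M c s) {r : ℕ} (hr : alive M s = {r}) :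
    (findRoot.eval s).nat 10 0 = r := by
  have hmem : ∀ w < M, s.nat 8 w = 0 ↔ w = r := by
    intro w hw
    have := Finset.ext_iff.mp hr w
    rw [mem_alive, mem_singleton] at this
    simpa [hw] using this
  have hrM : r < M := (mem_alive.mp (hr ▸ mem_singleton_self r)).1
  have key := eval_forLoop_induction (k := 20) (n := 1) (s := s)
    (c := .ite (natEq (.load 8 (reg 20)) (.lit 0)) (.setNat 10 (.lit 0) (reg 20)) .skip)
    (fun m s' => r < m → s'.nat 10 0 = r) ?_ (by simp) ?_
  · rw [hs.card_groups] at key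
    exact key hrM
  · intro m s' x h hm
    rw [nat_setNat_of_ne _ _ _ (by decide)]
    exact h hm
  · intro m hm s' hn _ hk h hrm
    rw [hs.card_groups] at hm
    have e8 : s'.nat 8 = s.nat 8 := hn 8 (by decide)
    have hm' := hmem m hm
    simp only [eval, holds_and, holds_natLe, value_load, value_lit, hk, e8]
    split_ifs with ht
    · simpa [nat_setNat] using hm'.mp (by omega)
    · have : m ≠ r := fun h' => ht (by rw [hm'.mpr h']; simp)
      exact h (by omega)

/-- Writes into register `12` the number of groups that may be taken, and into register `11`
whether the root should be taken. -/
def chooseRoot : ForProgram :=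
  .seq (.setNat 12 (.lit 0) (.sub (.load 0 (.lit 2)) (.sub (.load 0 (.lit 2)) (.load 0 (.lit 1)))))
    (.seq (.setNat 11 (.lit 0) (.lit 0))
      (.ite (.and (.natLe (.lit 1) (reg 12))
          (.not (.realLe
            (.load 2 (rowExpr (.add (.add (reg 10) (reg 10)) (.lit 1)) (.sub (reg 12) (.lit 1))))
            (.load 2 (rowExpr (.add (.add (reg 10) (reg 10)) (.lit 0)) (reg 12))))))
        (.setNat 11 (.lit 0) (.lit 1)) .skip))

/-- Copies the set of the entry that has been chosen into the array `2`. -/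
def copySelection : ForProgram :=
  .forLoop 20 1 (.setNat 2 (reg 20)
    (.load 7 (slabExpr (nodeExpr 10 11) (.sub (reg 12) (reg 11)) (reg 20))))

/-- Table budgets do not count the root. Taking it costs one unit, so the entry with digit 1 is read
at one capacity less, and only if the capacity is positive. -/
theorem chooseRoot_spec {s : Store} (hs : WeightsReady M c s) {r G : ℕ} (hrM : r < M)
    (h10 : s.nat 10 0 = r) (hG : s.nat 0 2 = G) :
    ∃ b ≤ 1, (chooseRoot.eval s).nat 11 0 = b ∧ (chooseRoot.eval s).nat 12 0 = min G M ∧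
      b ≤ min G M ∧ ∀ β ≤ 1, β ≤ min G M →
        tableValue M s r β (min G M - β) ≤ tableValue M s r b (min G M - b) := by
  -- Truncated subtraction yields the minimum without a test.
  have hg : G - (G - M) = min G M := by omega
  have h0 : s.nat 0 1 = M := hs.card_groups
  have e0 : s.nat 4 (r + r + 0) + min G M = rowCell M (r + r + 0) (min G M) :=
    hs.row_add (by omega) _
  have e1 : s.nat 4 (r + r + 1) + (min G M - 1) = rowCell M (r + r + 1) (min G M - 1) :=
    hs.row_add (by omega) _
  have d1 : ∀ i v, ((s.setNat 12 0 i).setNat 11 0 v).nat 12 0 = i := by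
    intro i v
    rw [nat_setNat_of_ne _ _ _ (by decide), nat_setNat, if_pos ⟨rfl, rfl⟩]
  have d2 : ∀ i v, ((s.setNat 12 0 i).setNat 11 0 v).nat 10 = s.nat 10 := by
    intro i v
    rw [nat_setNat_of_ne _ _ _ (by decide), nat_setNat_of_ne _ _ _ (by decide)]
  have d3 : ∀ i v, ((s.setNat 12 0 i).setNat 11 0 v).nat 4 = s.nat 4 := by
    intro i v
    rw [nat_setNat_of_ne _ _ _ (by decide), nat_setNat_of_ne _ _ _ (by decide)]
  have heval : chooseRoot.eval s =
      if 1 ≤ min G M ∧ tableValue M s r 0 (min G M) < tableValue M s r 1 (min G M - 1) then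
        ((s.setNat 12 0 (min G M)).setNat 11 0 0).setNat 11 0 1
      else (s.setNat 12 0 (min G M)).setNat 11 0 0 := by
    simp only [chooseRoot, eval, value_lit, value_sub, value_load, value_add, h0, hG, hg,
      holds_and, holds_natLe, holds_not, holds_realLe, realValue_load, d1, d2, d3, h10, e0, e1,
      not_le, real_setNat]
    rfl
  by_cases ht : 1 ≤ min G M ∧ tableValue M s r 0 (min G M) < tableValue M s r 1 (min G M - 1)
  · rw [heval, if_pos ht]
    refine ⟨1, le_rfl, by simp [nat_setNat], by simp [nat_setNat], ht.1, fun β hβ _ => ?_⟩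
    rcases (by omega : β = 0 ∨ β = 1) with rfl | rfl
    · exact ht.2.le
    · exact le_rfl
  · rw [heval, if_neg ht]
    refine ⟨0, by omega, by simp [nat_setNat], by simp [nat_setNat], by omega, fun β hβ hβ' => ?_⟩
    rcases (by omega : β = 0 ∨ β = 1) with rfl | rfl
    · exact le_rfl
    · exact not_lt.mp fun h => ht ⟨hβ', h⟩

/-- With one root left, its block is all of `range M`, so each competitor is admissible for the
digit that records whether it contains `r`. Replacing `G` by `min G M` excludes nothing, as no set
has more than `M` nodes. -/
theorem optimal_of_tableReady {s : Store} (h : TableReady M c f s) {r G b : ℕ}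
    (hr : alive M s = {r}) (hb : b ≤ 1) (hbG : b ≤ min G M)
    (hbest : ∀ β ≤ 1, β ≤ min G M →
        tableValue M s r β (min G M - β) ≤ tableValue M s r b (min G M - b)) :
    ∃ S, OptimalSelection M f G S ∧
      ∀ l < M, tableSet M s r b (min G M - b) l = if l ∈ S then 1 else 0 := by
  obtain ⟨B, hB, hent⟩ := h
  have hrR : r ∈ alive M s := hr ▸ mem_singleton_self r
  have hBr : B r = range M := by
    refine Subset.antisymm (hB.subset r hrR) fun l hl => ?_
    obtain ⟨v, hv, hlv⟩ := hB.cover l (mem_range.mp hl)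
    rw [hr, mem_singleton] at hv
    rwa [← hv]
  have hent' := hent r hrR
  rw [hBr] at hent'
  obtain ⟨S, hS, hF, hσ, -⟩ := hent' b hb (min G M - b) (by omega)
  have hcard : ∀ T : Finset ℕ, ∀ β ≤ 1, (r ∈ T ↔ β = 1) → T.card = (T.erase r).card + β := by
    intro T β hβ hT
    by_cases hrT : r ∈ T
    · rw [card_erase_of_mem hrT, hT.mp hrT]
      have := card_pos.mpr ⟨r, hrT⟩
      omega
    · have : β ≠ 1 := fun h' => hrT (hT.mpr h')
      rw [erase_eq_of_notMem hrT]
      omega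
  refine ⟨S, ⟨hS.1, ?_, fun T hT hTG => ?_⟩, hσ⟩
  · have := hcard S b hb hS.2.1
    have := hS.2.2
    omega
  · have hTM : T.card ≤ M := by simpa using card_le_card hT
    obtain ⟨β, hβ, hβT⟩ : ∃ β ≤ 1, (r ∈ T ↔ β = 1) := by
      by_cases hrT : r ∈ T
      · exact ⟨1, le_rfl, by simp [hrT]⟩
      · exact ⟨0, by omega, by simp [hrT]⟩
    have hc := hcard T β hβ hβT
    obtain ⟨S', hS', hF', -, hmax⟩ := hent' β hβ (min G M - β) (by omega)
    rw [← hF]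
    exact (hmax T ⟨hT, hβT, by omega⟩ trivial).trans (hbest β hβ (by omega))

theorem copySelection_spec {s : Store} (hs : WeightsReady M c s) {r b g : ℕ} (hrM : r < M)
    (hb : b ≤ 1) (hg : g ≤ M) (h10 : s.nat 10 0 = r) (h11 : s.nat 11 0 = b)
    (h12 : s.nat 12 0 = g) : ∀ l < M, (copySelection.eval s).nat 2 l = tableSet M s r b (g - b) l := by
  have key := eval_forLoop_induction (k := 20) (n := 1) (s := s)
    (c := .setNat 2 (reg 20)
      (.load 7 (slabExpr (nodeExpr 10 11) (.sub (reg 12) (reg 11)) (reg 20))))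
    (fun m s' => ∀ l < m, s'.nat 2 l = tableSet M s r b (g - b) l) ?_ (by simp) ?_
  · rw [hs.card_groups] at key
    exact key
  · intro m s' x h l hl
    rw [nat_setNat_of_ne _ _ _ (by decide)]
    exact h l hl
  · intro m hm s' hn hr hk h l hl
    have hs' : WeightsReady M c s' := hs.frame hn hr (by decide) (by decide)
    have e7 : s'.nat 7 = s.nat 7 := hn 7 (by decide)
    simp only [eval, value_load, value_add, value_sub, value_lit, nat_setNat, hk,
      hn 10 (by decide), hn 11 (by decide), hn 12 (by decide), h10, h11, h12, e7, true_and]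
    rw [hs'.slab_add (by omega) (by omega)]
    split_ifs with hl'
    · rw [hl']; rfl
    · exact h l (by omega)

end Init

/-! ### The covered variables -/

variable {N M : ℕ}

/-- Marks the variable in register `20` if the group in register `21` is selected and holds it. -/
def coverCell : ForProgram :=
  .ite (.and (incidenceTest 20 21) (.natLe (.lit 1) (.load 2 (reg 21))))
    (.setNat 3 (reg 20) (.lit 1)) .skip

/-- Marks a variable if it is covered. -/
def coverRow : ForProgram := .forLoop 21 1 coverCell

/-- Marks the variables that are covered. -/
def coverAll : ForProgram := .forLoop 20 0 coverRow

theorem coverRow_spec {𝔊 : GroupStructure N M} {x : Fin N → ℝ} {s : Store}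
    (h : InputReady 𝔊 x s) {S : Finset ℕ} (hS : S ⊆ range M)
    (hω : ∀ l < M, s.nat 2 l = if l ∈ S then 1 else 0) (i : Fin N) (h20 : s.nat 20 0 = i) :
    ∀ k : ℕ, (coverRow.eval s).nat 3 k =
      if k = i ∧ i ∈ S.biUnion (groupAt 𝔊) then 1 else s.nat 3 k := by
  have key := eval_forLoop_induction (k := 21) (n := 1) (s := s) (c := coverCell)
    (fun m s' => ∀ k : ℕ, s'.nat 3 k =
      if k = i ∧ ∃ j < m, j ∈ S ∧ i ∈ groupAt 𝔊 j then 1 else s.nat 3 k) ?_ (by simp) ?_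
  · rw [h.card_groups] at key
    intro k
    refine (key k).trans (if_congr (and_congr_right fun _ => ?_) rfl rfl)
    rw [mem_biUnion]
    exact ⟨fun ⟨j, _, hj⟩ => ⟨j, hj⟩, fun ⟨j, hj⟩ => ⟨j, mem_range.mp (hS hj.1), hj⟩⟩
  · intro m s' v hP
    rwa [nat_setNat_of_ne _ _ _ (by decide)]
  · intro m hm s' hn hr hk hP k
    rw [h.card_groups] at hm
    have hs' : InputReady 𝔊 x s' := h.frame hn hr (by decide) (by decide)
    have e20 : s'.nat 20 0 = i := by rw [hn 20 (by decide), h20]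
    have e2 : s'.nat 2 m = if m ∈ S then 1 else 0 := by rw [hn 2 (by decide), hω m hm]
    have h1 : 1 ≤ s'.nat 2 m ↔ m ∈ S := by
      rw [e2]
      split_ifs with hmS <;> simp [hmS]
    have heval : coverCell.eval s' =
        if i ∈ groupAt 𝔊 m ∧ m ∈ S then s'.setNat 3 i 1 else s' := by
      simp only [coverCell, eval, holds_and, holds_incidenceTest hs' i e20 hk hm, value_load,
        value_lit, e20, holds_natLe, hk, h1]
    rw [heval]
    by_cases ht : i ∈ groupAt 𝔊 m ∧ m ∈ S
    · rw [if_pos ht, nat_setNat, hP k]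
      by_cases hki : k = i
      · rw [if_pos ⟨rfl, hki⟩, if_pos ⟨hki, m, by omega, ht.2, ht.1⟩]
      · rw [if_neg (fun h' => hki h'.2), if_neg (fun h' => hki h'.1), if_neg (fun h' => hki h'.1)]
    · rw [if_neg ht, hP k]
      refine if_congr (and_congr_right fun _ => ?_) rfl rfl
      refine ⟨fun ⟨j, hj, hj'⟩ => ⟨j, by omega, hj'⟩, fun ⟨j, hj, hj'⟩ => ⟨j, ?_, hj'⟩⟩
      have : j ≠ m := fun h' => ht (h' ▸ hj'.symm)
      omega

theorem coverAll_spec {𝔊 : GroupStructure N M} {x : Fin N → ℝ} {s : Store}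
    (h : InputReady 𝔊 x s) {S : Finset ℕ} (hS : S ⊆ range M)
    (hω : ∀ l < M, s.nat 2 l = if l ∈ S then 1 else 0) (h3 : ∀ k, s.nat 3 k = 0) :
    ∀ i : Fin N, (coverAll.eval s).nat 3 i = if i ∈ S.biUnion (groupAt 𝔊) then 1 else 0 := by
  have key := eval_forLoop_induction (k := 20) (n := 0) (s := s) (c := coverRow)
    (fun m s' => ∀ i : Fin N, s'.nat 3 i =
      if (i : ℕ) < m ∧ i ∈ S.biUnion (groupAt 𝔊) then 1 else 0) ?_ (by simp [h3]) ?_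
  · rw [h.card_variables] at key
    intro i
    refine (key i).trans (if_congr ?_ rfl rfl)
    simp
  · intro m s' v hP i
    rw [nat_setNat_of_ne _ _ _ (by decide)]
    exact hP i
  · intro m hm s' hn hr hk hP i
    rw [h.card_variables] at hm
    have hs' : InputReady 𝔊 x s' := h.frame hn hr (by decide) (by decide)
    have hω' : ∀ l < M, s'.nat 2 l = if l ∈ S then 1 else 0 := by
      rw [hn 2 (by decide)]; exact hω
    rw [coverRow_spec hs' hS hω' ⟨m, hm⟩ hk i, hP i]
    by_cases him : i = ⟨m, hm⟩
    · simp [him]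
    · have h1 : (i : ℕ) ≠ m := fun h' => him (Fin.ext h')
      have h2 : (i : ℕ) < m + 1 ↔ (i : ℕ) < m := by omega
      simp [h1, h2]

/-- For a feasible pair, each variable with `y' i = 1` lies in a group selected by `ω'`. Its
objective is therefore at most the coverage of the support of `ω'`, and marking all covered
variables attains the coverage. -/
theorem isSolution_of_optimalSelection {𝔊 : GroupStructure N M} {x : Fin N → ℝ} {G : ℕ}
    {S : Finset ℕ} (hS : OptimalSelection M (coverage 𝔊 x) G S) {ω : Fin M → ℕ} {y : Fin N → ℕ}
    (hω : ∀ j : Fin M, ω j = if (j : ℕ) ∈ S then 1 else 0)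
    (hy : ∀ i, y i = if i ∈ S.biUnion (groupAt 𝔊) then 1 else 0) : IsSolution 𝔊 G x ω y := by
  obtain ⟨hSM, hSG, hmax⟩ := hS
  have hobj : objective x y = coverage 𝔊 x S := by
    unfold objective coverage
    simp only [hy, Nat.cast_ite, Nat.cast_one, Nat.cast_zero, ite_mul, one_mul, zero_mul]
    rw [sum_ite_mem, univ_inter]
  refine ⟨⟨fun j => ?_, fun i => ?_, fun i => ?_, ?_⟩, fun ω' y' hF => ?_⟩
  · rw [hω]; split_ifs <;> simp
  · rw [hy]; split_ifs <;> simp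
  · rw [hy]
    split_ifs with hi
    · obtain ⟨j, hj, hij⟩ := mem_biUnion.mp hi
      obtain ⟨hjM, hij⟩ := mem_groupAt.mp hij
      refine le_trans ?_ (single_le_sum (f := fun k => 𝔊.biadj i k * ω k)
        (fun _ _ => Nat.zero_le _) (mem_univ (⟨j, hjM⟩ : Fin M)))
      simp [GroupStructure.biadj, hij, hω, hj]
    · exact Nat.zero_le _
  · simp only [hω]
    rw [Fin.sum_univ_eq_sum_range (fun j => if j ∈ S then 1 else 0) M, sum_ite_mem]
    simpa [inter_eq_right.mpr hSM] using hSG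
  · obtain ⟨hω', hy', hcov, hG⟩ := hF
    set T : Finset ℕ := (univ.filter fun j => ω' j = 1).map Fin.valEmbedding with hT
    have hTM : T ⊆ range M := by
      intro a ha
      obtain ⟨j, -, rfl⟩ := mem_map.mp ha
      exact mem_range.mpr j.2
    have hTG : T.card ≤ G := by
      rw [hT, card_map, card_filter]
      refine le_trans (sum_le_sum fun j _ => ?_) hG
      split_ifs with h <;> omega
    rw [hobj]
    refine le_trans ?_ (hmax T hTM hTG)
    unfold objective coverage
    rw [← univ_inter (T.biUnion (groupAt 𝔊)), ← sum_ite_mem]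
    refine sum_le_sum fun i _ => ?_
    rcases hy' i with h0 | h1
    · rw [h0]
      split_ifs <;> simp [sq_nonneg]
    · have hpos : 0 < (𝔊.biadj.mulVec ω') i := by
        have := hcov i
        omega
      obtain ⟨j, -, hj⟩ := exists_ne_zero_of_sum_ne_zero
        (show ∑ k, 𝔊.biadj i k * ω' k ≠ 0 from hpos.ne')
      have hij : i ∈ 𝔊.group j := by
        by_contra hij
        simp [GroupStructure.biadj, hij] at hj
      have hjω : ω' j = 1 := (hω' j).resolve_left fun h => hj (by rw [h, Nat.mul_zero])
      have hmem : i ∈ T.biUnion (groupAt 𝔊) :=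
        mem_biUnion.mpr ⟨j, mem_map.mpr ⟨j, by simpa using hjω, rfl⟩,
          mem_groupAt.mpr ⟨j.2, hij⟩⟩
      rw [if_pos hmem, h1]
      simp

/-! ### The algorithm -/

/-- Computes the sizes of the tables. -/
def sizes : Program :=
  .seq (.setNat 0 (.lit 3) (.add (.load 0 (.lit 1)) (.lit 1)))
    (.seq (.setNat 0 (.lit 4) (.lit 2))
      (.setNat 0 (.lit 5) (.add (.load 0 (.lit 3)) (.load 0 (.lit 3)))))

/-- Computes the multiples needed for addresses. -/
def addresses : ForProgram :=
  .seq (multiples 4 20 5 (.load 0 (.lit 3)))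
    (.seq (multiples 5 20 5 (.load 4 (.load 0 (.lit 3)))) (multiples 6 20 0 (.load 0 (.lit 1))))

/-- Computes the weights. -/
def weights : ForProgram := .seq overlapTable (.setReal 3 (.lit 1) (.lit 1))

/-- Reads off the solution from the table. -/
def readSolution : ForProgram :=
  .seq findRoot (.seq chooseRoot (.seq copySelection coverAll))

/-- The dynamic program for the weighted maximum coverage problem. -/
def mainProgram : ForProgram :=
  .seq addresses (.seq weights (.seq initTable (.seq eliminateAll readSolution)))

/-- The store in which the sizes have been computed. -/
noncomputable def sizedInput (𝔊 : GroupStructure N M) (G : ℕ) (x : Fin N → ℝ) : Store :=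
  (((input 𝔊 G x).setNat 0 3 (M + 1)).setNat 0 4 2).setNat 0 5 (2 * (M + 1))

/-- This preamble writes the loop bounds into array `0`, which the counted-loop programs must leave
alone; hence it is treated directly as a machine program. -/
theorem runs_sizes (𝔊 : GroupStructure N M) (G : ℕ) (x : Fin N → ℝ) :
    ∃ t, t ≤ 20 ∧ Runs sizes (input 𝔊 G x) (sizedInput 𝔊 G x) t := by
  have h : sizedInput 𝔊 G x = (((input 𝔊 G x).setNat 0 3 ((input 𝔊 G x).nat 0 1 + 1)).setNat 0 4
      2).setNat 0 5 ((((input 𝔊 G x).setNat 0 3 ((input 𝔊 G x).nat 0 1 + 1)).setNat 0 4 2).nat 0 3 +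
        (((input 𝔊 G x).setNat 0 3 ((input 𝔊 G x).nat 0 1 + 1)).setNat 0 4 2).nat 0 3) := by
    simp [sizedInput, nat_setNat, input, two_mul]
  rw [h]
  refine ⟨_, ?_, .seq (.setNat _ _ _ _) (.seq (.setNat _ _ _ _) (.setNat _ _ _ _))⟩
  simp [NatExpr.cost]

theorem sizedInput_zero (𝔊 : GroupStructure N M) (G : ℕ) (x : Fin N → ℝ) (k : ℕ) :
    (sizedInput 𝔊 G x).nat 0 k = if k = 5 then 2 * (M + 1) else if k = 4 then 2 else
      if k = 3 then M + 1 else if k = 2 then G else if k = 1 then M else if k = 0 then N else 0 := by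
  simp only [sizedInput, nat_setNat, true_and]
  split_ifs <;> first | rfl | simp_all [input]

theorem sizedInput_nat (𝔊 : GroupStructure N M) (G : ℕ) (x : Fin N → ℝ) {a : ℕ} (ha : a ≠ 0) :
    (sizedInput 𝔊 G x).nat a = (input 𝔊 G x).nat a := by
  unfold sizedInput
  rw [nat_setNat_of_ne _ _ _ ha, nat_setNat_of_ne _ _ _ ha, nat_setNat_of_ne _ _ _ ha]

theorem addresses_spec (𝔊 : GroupStructure N M) (G : ℕ) (x : Fin N → ℝ) :
    InputReady 𝔊 x (addresses.eval (sizedInput 𝔊 G x)) ∧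
      ∀ i ≤ 2 * (M + 1), (addresses.eval (sizedInput 𝔊 G x)).nat 5 i =
        i * ((M + 1) * (M + 1)) := by
  set s := sizedInput 𝔊 G x with hs
  have z := sizedInput_zero 𝔊 G x
  rw [← hs] at z
  have hnat : ∀ a, a ≠ 0 → s.nat a = (input 𝔊 G x).nat a := fun a ha => sizedInput_nat 𝔊 G x ha
  set s₁ := (multiples 4 20 5 (.load 0 (.lit 3))).eval s with hs₁
  have n₁ : ∀ a, a ∉ [20, 4] → s₁.nat a = s.nat a := fun a ha => eval_nat _ s ha
  set s₂ := (multiples 5 20 5 (.load 4 (.load 0 (.lit 3)))).eval s₁ with hs₂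
  have n₂ : ∀ a, a ∉ [20, 5] → s₂.nat a = s₁.nat a := fun a ha => eval_nat _ s₁ ha
  set s₃ := (multiples 6 20 0 (.load 0 (.lit 1))).eval s₂ with hs₃
  have n₃ : ∀ a, a ∉ [20, 6] → s₃.nat a = s₂.nat a := fun a ha => eval_nat _ s₂ ha
  have heval : addresses.eval s = s₃ := rfl
  have z₁ : s₁.nat 0 = s.nat 0 := n₁ 0 (by decide)
  have z₂ : s₂.nat 0 = s.nat 0 := (n₂ 0 (by decide)).trans z₁
  have z₃ : s₃.nat 0 = s.nat 0 := (n₃ 0 (by decide)).trans z₂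
  have t₁ : ∀ i ≤ 2 * (M + 1), s₁.nat 4 i = i * (M + 1) := by
    have := multiples_spec (a := 4) (k := 20) (n := 5) (w := M + 1) (e := .load 0 (.lit 3))
      (s := s) (by decide) (by rw [hnat 4 (by decide)]; rfl) (fun s' h => by
        rw [value_load, value_lit, h 0 (by decide) (by decide), z]; rfl)
    rw [z] at this
    exact this
  -- The slab size $(M+1)^2$ is itself obtained as the entry `M + 1` of the table of row multiples.
  have t₂ : ∀ i ≤ 2 * (M + 1), s₂.nat 5 i = i * ((M + 1) * (M + 1)) := by
    have := multiples_spec (a := 5) (k := 20) (n := 5) (w := (M + 1) * (M + 1))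
      (e := .load 4 (.load 0 (.lit 3))) (s := s₁) (by decide)
      (by rw [n₁ 5 (by decide), hnat 5 (by decide)]; rfl) (fun s' h => by
        rw [value_load, value_load, value_lit, h 0 (by decide) (by decide),
          h 4 (by decide) (by decide), z₁, z]
        exact t₁ (M + 1) (by omega))
    rw [z₁, z] at this
    exact this
  have t₃ : ∀ i ≤ N, s₃.nat 6 i = i * M := by
    have := multiples_spec (a := 6) (k := 20) (n := 0) (w := M)
      (e := .load 0 (.lit 1)) (s := s₂) (by decide)
      (by rw [n₂ 6 (by decide), n₁ 6 (by decide), hnat 6 (by decide)]; rfl) (fun s' h => by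
        rw [value_load, value_lit, h 0 (by decide) (by decide), z₂, z]; rfl)
    rw [z₂, z] at this
    exact this
  rw [heval]
  refine ⟨⟨?_, ?_, ?_, ?_, ?_⟩, ?_⟩
  · rw [z₃, z]; rfl
  · rw [z₃, z]; rfl
  · rw [n₃ 4 (by decide), n₂ 4 (by decide)]; exact t₁
  · intro i j hj
    rw [t₃ i i.2.le, n₃ 1 (by decide), n₂ 1 (by decide), n₁ 1 (by decide), hnat 1 (by decide)]
    have hlt : (i : ℕ) * M + j < N * M := by
      calc (i : ℕ) * M + j < i * M + M := by omega
        _ = (i + 1) * M := by ring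
        _ ≤ N * M := Nat.mul_le_mul_right _ i.2
    have hdiv : Fin.divNat (⟨i * M + j, hlt⟩ : Fin (N * M)) = i := by
      ext
      simp only [Fin.coe_divNat]
      rw [Nat.add_comm, Nat.add_mul_div_right _ _ (by omega), Nat.div_eq_of_lt hj, Nat.zero_add]
    have hmod : Fin.modNat (⟨i * M + j, hlt⟩ : Fin (N * M)) = ⟨j, hj⟩ := by
      ext
      simp only [Fin.coe_modNat]
      rw [Nat.add_comm, Nat.add_mul_mod_self_right, Nat.mod_eq_of_lt hj]
    simp only [input, dif_pos hlt, hdiv, hmod]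
    simp [GroupStructure.biadj, groupAt, hj]
  · intro i
    have hreal : s₃.real 0 = (input 𝔊 G x).real 0 := by
      rw [hs₃, eval_real _ s₂ (by decide), hs₂, eval_real _ s₁ (by decide), hs₁,
        eval_real _ s (by decide)]
      rfl
    rw [hreal]
    simp [input]
  · rw [n₃ 5 (by decide)]; exact t₂

theorem mainProgram_spec {𝔊 : GroupStructure N M} (h : 𝔊.LooplessPairwiseOverlapping) (G : ℕ)
    (x : Fin N → ℝ) : IsSolution 𝔊 G x
      (outputGroups M (mainProgram.eval (sizedInput 𝔊 G x)))
      (outputVariables N (mainProgram.eval (sizedInput 𝔊 G x))) := by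
  have hf := pairwiseCoverage h x
  have z := sizedInput_zero 𝔊 G x
  obtain ⟨ha, h5⟩ := addresses_spec 𝔊 G x
  set s := sizedInput 𝔊 G x with hs
  have hnat : ∀ a, a ≠ 0 → s.nat a = (input 𝔊 G x).nat a := fun a ha => sizedInput_nat 𝔊 G x ha
  have hreal : s.real = (input 𝔊 G x).real := rfl
  set s₁ := addresses.eval s with hs₁
  have n₁ : ∀ a, a ∉ addresses.natWrites → s₁.nat a = s.nat a := fun a h => eval_nat _ s h
  have r₁ : ∀ a, a ∉ addresses.realWrites → s₁.real a = s.real a := fun a h => eval_real _ s h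
  set s₂ := weights.eval s₁ with hs₂
  have n₂ : ∀ a, a ∉ weights.natWrites → s₂.nat a = s₁.nat a := fun a h => eval_nat _ s₁ h
  have r₂ : ∀ a, a ∉ weights.realWrites → s₂.real a = s₁.real a := fun a h => eval_real _ s₁ h
  set s₃ := initTable.eval s₂ with hs₃
  have n₃ : ∀ a, a ∉ initTable.natWrites → s₃.nat a = s₂.nat a := fun a h => eval_nat _ s₂ h
  have r₃ : ∀ a, a ∉ initTable.realWrites → s₃.real a = s₂.real a := fun a h => eval_real _ s₂ h
  set s₄ := eliminateAll.eval s₃ with hs₄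
  have n₄ : ∀ a, a ∉ eliminateAll.natWrites → s₄.nat a = s₃.nat a := fun a h => eval_nat _ s₃ h
  have r₄ : ∀ a, a ∉ eliminateAll.realWrites → s₄.real a = s₃.real a :=
    fun a h => eval_real _ s₃ h
  set s₅ := findRoot.eval s₄ with hs₅
  have n₅ : ∀ a, a ∉ findRoot.natWrites → s₅.nat a = s₄.nat a := fun a h => eval_nat _ s₄ h
  have r₅ : ∀ a, a ∉ findRoot.realWrites → s₅.real a = s₄.real a := fun a h => eval_real _ s₄ h
  set s₆ := chooseRoot.eval s₅ with hs₆
  have n₆ : ∀ a, a ∉ chooseRoot.natWrites → s₆.nat a = s₅.nat a := fun a h => eval_nat _ s₅ h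
  have r₆ : ∀ a, a ∉ chooseRoot.realWrites → s₆.real a = s₅.real a := fun a h => eval_real _ s₅ h
  set s₇ := copySelection.eval s₆ with hs₇
  have n₇ : ∀ a, a ∉ copySelection.natWrites → s₇.nat a = s₆.nat a := fun a h => eval_nat _ s₆ h
  have r₇ : ∀ a, a ∉ copySelection.realWrites → s₇.real a = s₆.real a :=
    fun a h => eval_real _ s₆ h
  have heval : mainProgram.eval s = coverAll.eval s₇ := rfl
  have z₁ : s₁.nat 0 = s.nat 0 := n₁ 0 (by decide)
  have w₂ : WeightsReady M (overlap 𝔊 x) s₂ := by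
    have z₂ : s₂.nat 0 = s.nat 0 := (n₂ 0 (by decide)).trans z₁
    refine ⟨?_, ?_, ?_, ?_, ?_, fun a ha' b hb => ?_, fun b hb => ?_⟩
    · rw [z₂, z]; rfl
    · rw [z₂, z]; rfl
    · rw [z₂, z]; rfl
    · rw [n₂ 4 (by decide)]; exact ha.row
    · rw [n₂ 5 (by decide)]; exact h5
    · have h1 : s₂.real 1 = (overlapTable.eval s₁).real 1 := real_setReal_of_ne _ _ _ (by decide)
      have h0 : ∀ q, s₁.real 1 q = 0 := by
        intro q
        rw [r₁ 1 (by decide), hreal]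
        rfl
      rw [h1, overlapTable_spec ha a ha' b hb, h0, zero_add]
    · have h3 : s₂.real 3 b = if 3 = 3 ∧ b = 1 then ((1 : ℕ) : ℝ) else
          (overlapTable.eval s₁).real 3 b := real_setReal _ _ _ _ _ _
      rw [h3, eval_real overlapTable s₁ (by decide), r₁ 3 (by decide), hreal]
      rcases (by omega : b = 0 ∨ b = 1) with rfl | rfl
      · simp [input]
      · simp
  have w₃ : WeightsReady M (overlap 𝔊 x) s₃ := w₂.frame n₃ r₃ (by decide) (by decide)
  have w₄ : WeightsReady M (overlap 𝔊 x) s₄ := w₃.frame n₄ r₄ (by decide) (by decide)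
  have w₅ : WeightsReady M (overlap 𝔊 x) s₅ := w₄.frame n₅ r₅ (by decide) (by decide)
  have w₆ : WeightsReady M (overlap 𝔊 x) s₆ := w₅.frame n₆ r₆ (by decide) (by decide)
  have i₇ : InputReady 𝔊 x s₇ := by
    refine InputReady.frame ?_ n₇ r₇ (by decide) (by decide)
    refine InputReady.frame ?_ n₆ r₆ (by decide) (by decide)
    refine InputReady.frame ?_ n₅ r₅ (by decide) (by decide)
    refine InputReady.frame ?_ n₄ r₄ (by decide) (by decide)
    refine InputReady.frame ?_ n₃ r₃ (by decide) (by decide)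
    exact InputReady.frame ha n₂ r₂ (by decide) (by decide)
  obtain ⟨hT₃, hA₃⟩ := initTable_spec hf w₂
    (fun q => by rw [r₂ 2 (by decide), r₁ 2 (by decide), hreal]; rfl)
    (fun q => by rw [n₂ 7 (by decide), n₁ 7 (by decide), hnat 7 (by decide)]; rfl)
    (fun q => by rw [n₂ 8 (by decide), n₁ 8 (by decide), hnat 8 (by decide)]; rfl)
  have hselect : ∃ S, OptimalSelection M (coverage 𝔊 x) G S ∧
      ∀ l < M, s₇.nat 2 l = if l ∈ S then 1 else 0 := by
    rcases Nat.eq_zero_or_pos M with hM | hM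
    -- Without groups there is no root to find; the empty selection is the only one, and no entry of
    -- `ω` has to be checked.
    · refine ⟨∅, ⟨empty_subset _, by simp, fun T hT _ => ?_⟩, fun l hl => by omega⟩
      rw [hM, range_zero, subset_empty] at hT
      rw [hT]
    · obtain ⟨hT₄, r, hr⟩ := eliminateAll_spec hf w₃ hT₃ (by
        rw [hA₃]; exact ⟨0, mem_range.mpr hM⟩)
      rw [← hs₄] at hT₄ hr
      have hrM : r < M := (mem_alive.mp (hr ▸ mem_singleton_self r)).1
      have h10 : s₅.nat 10 0 = r := findRoot_spec w₄ hr
      have hT₅ : TableReady M (overlap 𝔊 x) (coverage 𝔊 x) s₅ :=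
        hT₄.congr (r₅ 2 (by decide)) (n₅ 7 (by decide)) (n₅ 8 (by decide))
      have hA₅ : alive M s₅ = {r} := (alive_congr (n₅ 8 (by decide))).trans hr
      have hG : s₅.nat 0 2 = G := by
        rw [n₅ 0 (by decide), n₄ 0 (by decide), n₃ 0 (by decide), n₂ 0 (by decide), z₁, z]; rfl
      obtain ⟨b, hb, h11, h12, hbG, hbest⟩ := chooseRoot_spec w₅ hrM h10 hG
      obtain ⟨S, hS, hσ⟩ := optimal_of_tableReady hT₅ hA₅ hb hbG hbest
      refine ⟨S, hS, fun l hl => ?_⟩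
      rw [← hσ l hl, copySelection_spec w₆ hrM hb (min_le_right G M)
        (by rw [n₆ 10 (by decide), h10]) h11 h12 l hl]
      unfold tableSet
      rw [n₆ 7 (by decide)]
  obtain ⟨S, hS, hω⟩ := hselect
  have hy := coverAll_spec i₇ hS.1 hω (fun k => by
    rw [n₇ 3 (by decide), n₆ 3 (by decide), n₅ 3 (by decide), n₄ 3 (by decide), n₃ 3 (by decide),
      n₂ 3 (by decide), n₁ 3 (by decide), hnat 3 (by decide)]
    rfl)
  rw [heval]
  refine isSolution_of_optimalSelection hS (fun j => ?_) hy
  unfold outputGroups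
  rw [eval_nat coverAll s₇ (by decide)]
  exact hω j j.2

end WMC

theorem proposition2 :
    ∃ (P : RealRAM.Program) (p : Polynomial ℕ),
      ∀ (N M : ℕ) (𝔊 : GroupStructure N M), 𝔊.LooplessPairwiseOverlapping →
        ∀ (G : ℕ) (x : Fin N → ℝ),
          ∃ (s : RealRAM.Store) (t : ℕ),
            RealRAM.Runs P (WMC.input 𝔊 G x) s t ∧
            t ≤ p.eval (N + M) ∧
            WMC.IsSolution 𝔊 G x (WMC.outputGroups M s) (WMC.outputVariables N s) := by
  -- The loop bounds available in array `0`, apart from the excluded `G`, are `N`, `M`, `M + 1`, `2`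
  -- and `2 * (M + 1)`, all at most `2 * (N + M) + 2`; hence the substitution. The constant 20 pays
  -- for the preamble.
  refine ⟨.seq WMC.sizes WMC.mainProgram.compile,
    .C 20 + WMC.mainProgram.timeBound.comp (2 * .X + 2), fun N M 𝔊 h𝔊 G x => ?_⟩
  obtain ⟨t₁, ht₁, h₁⟩ := WMC.runs_sizes 𝔊 G x
  obtain ⟨t₂, ht₂, h₂⟩ := WMC.mainProgram.runs_compile (WMC.sizedInput 𝔊 G x)
    (B := 2 * (N + M) + 2) (by decide) (by decide) (fun n hn => by
      rw [WMC.sizedInput_zero]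
      split_ifs <;> omega)
  refine ⟨_, _, .seq h₁ h₂, ?_, WMC.mainProgram_spec h𝔊 G x⟩
  simp only [Polynomial.eval_add, Polynomial.eval_C, Polynomial.eval_comp, Polynomial.eval_mul,
    Polynomial.eval_X, Polynomial.eval_ofNat]
  omega
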